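/- A crossing-free straight-line drawing of a finite simple graph $G$ in $\mathbb R^3$ places the vertices at distinct points and draws each edge as the straight segment between its end points, such that no vertex lies in the interior of an edge and the interiors of distinct edges are disjoint. The strong plane cover number $\rho^2_3(G)$ is the minimum number of planes in $\mathbb R^3$ such that $G$ has a crossing-free straight-line drawing (vertices and edges) contained in the union of these planes. (i) Let $G$ be a graph on $n\ge 7$ vertices with $\rho^2_3(G)=2$. Then $G$ has a crossing-free straight-line drawing in $\mathbb R^3$ contained in the union of two distinct planes, and $G$ has at most $5n-19$ edges. (ii) The bound is tight for every $n\ge 7$. Let $S_n$ be the $n$-vertex graph consisting of a path $P$ on $n-4$ vertices and four further vertices $a_1,a_2,b_1,b_2$, each adjacent to all vertices of $P$, together with the two edges $a_1a_2$ and $b_1b_2$. Then $\rho^2_3(S_n)=2$ and $S_n$ has exactly $5n-19$ edges. Moreover, there are two planes $A,B\subset\mathbb R^3$ that intersect in a line $\ell$ (the spine), and a crossing-free straight-line drawing of $S_n$ contained in $A\cup B$, such that all vertices of $P$ lie on $\ell$, the vertices $a_1,a_2$ lie in the two opposite open half-planes of $A\setminus \ell$, and $b_1,b_2$ lie in the two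 opposite open half-planes of $B\setminus \ell$. -/

import Mathlib

/-- A crossing-free straight-line drawing of `G` in `ℝ^d`: distinct vertices are placed at distinct
points, every edge is drawn as the segment joining its end points, no vertex lies in the relative
interior of an edge, and the relative interiors of distinct edges are disjoint.  (Equivalently, two
distinct edges meet at most in a common end point.) -/
structure StraightLineDrawing {V : Type*} (G : SimpleGraph V) (d : ℕ) where
  /-- the position of each vertex -/
  pos : V → EuclideanSpace ℝ (Fin d)
  pos_injective : Function.Injective pos
  vertex_notMem_edge : ∀ u v w : V, G.Adj u v → pos w ∉ openSegment ℝ (pos u) (pos v)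
  edges_disjoint : ∀ u v x y : V, G.Adj u v → G.Adj x y → s(u, v) ≠ s(x, y) →
    Disjoint (openSegment ℝ (pos u) (pos v)) (openSegment ℝ (pos x) (pos y))

namespace StraightLineDrawing

/-- The point set of a drawing: all vertices together with all (closed) edge segments. -/
def carrier {V : Type*} {G : SimpleGraph V} {d : ℕ} (D : StraightLineDrawing G d) :
    Set (EuclideanSpace ℝ (Fin d)) :=
  Set.range D.pos ∪ {p | ∃ u v : V, G.Adj u v ∧ p ∈ segment ℝ (D.pos u) (D.pos v)}

end StraightLineDrawing

/-- `A` is an `l`-dimensional plane (nonempty affine subspace of dimension `l`) in `ℝ^d`. -/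
def IsFlat {d : ℕ} (l : ℕ) (A : AffineSubspace ℝ (EuclideanSpace ℝ (Fin d))) : Prop :=
  (A : Set (EuclideanSpace ℝ (Fin d))).Nonempty ∧ Module.finrank ℝ A.direction = l

/-- The `l`-dimensional affine cover number `ρ^l_d(G)`: the minimum number of `l`-dimensional planes
in `ℝ^d` such that `G` has a crossing-free straight-line drawing contained in the union of these
planes (`⊤` if no family of planes works). -/
noncomputable def affineCoverNumber {V : Type*} (l d : ℕ) (G : SimpleGraph V) : ℕ∞ :=
  sInf {k : ℕ∞ | ∃ P : Set (AffineSubspace ℝ (EuclideanSpace ℝ (Fin d))),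
    (∀ A ∈ P, IsFlat l A) ∧ P.encard = k ∧
    ∃ D : StraightLineDrawing G d, D.carrier ⊆ ⋃ A ∈ P, (A : Set (EuclideanSpace ℝ (Fin d)))}

/-- The strong plane cover number `ρ^2_3(G)`. -/
noncomputable def strongPlaneCoverNumber {V : Type*} (G : SimpleGraph V) : ℕ∞ :=
  affineCoverNumber 2 3 G

/-- Adjacency in `spineGraph k`. -/
def spineAdj (k : ℕ) : Fin k ⊕ (Bool × Bool) → Fin k ⊕ (Bool × Bool) → Prop
  | .inl i, .inl j => (SimpleGraph.pathGraph k).Adj i j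
  | .inl _, .inr _ => True
  | .inr _, .inl _ => True
  | .inr x, .inr y => x.1 = y.1 ∧ x.2 ≠ y.2

/-- A path on `k` vertices (the left summand) together with four further vertices `(c, h)`, where `c`
selects one of two planes and `h` one of the two half-planes of that plane.  Each of the four is
joined to all path vertices and to the vertex of the opposite half-plane of the same plane. -/
def spineGraph (k : ℕ) : SimpleGraph (Fin k ⊕ (Bool × Bool)) where
  Adj := spineAdj k
  symm := ⟨by
    rintro (i | x) (j | y) h
    · exact SimpleGraph.Adj.symm (G := SimpleGraph.pathGraph k) h
    · trivial
    · trivial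
    · exact ⟨h.1.symm, h.2.symm⟩⟩
  loopless := ⟨by
    rintro (i | x) h
    · exact (SimpleGraph.pathGraph k).irrefl h
    · exact h.2 rfl⟩

/-! The bound `3n - 6` for one plane comes from a sweep-line charge rather than Euler's formula. In
coordinates with distinct abscissas, orient the edges from left to right. The lowest edge arriving
at a point is charged to that point. Any other edge `e` bounds a wedge with the next lower edge `g`
arriving at the same point. No edge enters this wedge to the right of its rightmost vertex `u`, so
`e` is determined either as the first edge above `u`, or, when it starts at `u`, by the first edge
`g` below `u`. The leftmost point receives no charge, the two extreme points are spanned by no edge,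
and one further slot stays free, leaving `(n - 1) + 2(n - 2) - 1` charges (`IsSweepSystem.card_le`).

For two planes, let `s` points lie on both planes and `a`, `b` points on one plane only. If `a` or
`b` is at most 2, a crude count of the edges on that side combines with the plane bound for the
other plane or, when `a = b = 1`, with a crude count there too. If `a, b ≥ 3` and `s ≥ 1`, the spine
points bound `s - 1` gaps, of which `c_A`, `c_B` are crossed by edges of the two sides. Adding the
uncrossed gaps to a side as extra planar edges gives `e_A ≤ 3(s + a) - 6 - (s - 1) + c_A`, and
similarly for `B`. A crossed gap is not an edge, so at most `s - 1 - max(c_A, c_B)` edges lie on the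
spine. The total is at most `3n + 2s - 11 + min(c_A, c_B)`. Distinct crossed gaps need distinct
edges between off-spine points, so `c_A ≤ 3a - 6` and `c_B ≤ 3b - 6`, which yields `5n - 19`.

For tightness, `5n - 19 > 3n - 6` when `n ≥ 7`, so the explicit drawing of the spine graph cannot be
replaced by one in a single plane. -/

/-! ### Sweep-line bound for crossing-free segments in coordinates -/

/-- The slope of the segment joining the two points of `e` in the plane with coordinates `X`, `Y`. -/
noncomputable def edgeSlope {V : Type*} (X Y : V → ℝ) (e : V × V) : ℝ :=
  (Y e.2 - Y e.1) / (X e.2 - X e.1)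

/-- The height over `x` of the line through the two points of `e`. -/
noncomputable def edgeHeight {V : Type*} (X Y : V → ℝ) (e : V × V) (x : ℝ) : ℝ :=
  Y e.2 - edgeSlope X Y e * (X e.2 - x)

theorem edgeHeight_snd {V : Type*} (X Y : V → ℝ) (e : V × V) :
    edgeHeight X Y e (X e.2) = Y e.2 := by
  simp [edgeHeight]

theorem edgeHeight_fst {V : Type*} (X Y : V → ℝ) (e : V × V) (h : X e.1 < X e.2) :
    edgeHeight X Y e (X e.1) = Y e.1 := by
  have : X e.2 - X e.1 ≠ 0 := by linarith
  unfold edgeHeight edgeSlope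
  field_simp
  ring

/-- Two lines that change their vertical order meet in between. -/
theorem exists_edgeHeight_eq {V : Type*} (X Y : V → ℝ) (e f : V × V) {a b : ℝ} (hab : a < b)
    (ha : edgeHeight X Y e a < edgeHeight X Y f a)
    (hb : edgeHeight X Y f b < edgeHeight X Y e b) :
    ∃ x, a < x ∧ x < b ∧ edgeHeight X Y e x = edgeHeight X Y f x := by
  have hc : ∀ g : V × V, Continuous (edgeHeight X Y g) := fun g ↦ by
    unfold edgeHeight; fun_prop
  have h := intermediate_value_Ioo hab.le ((hc e).sub (hc f)).continuousOn
  obtain ⟨x, hx, hx0⟩ := h (show (0 : ℝ) ∈ _ from ⟨by simpa using ha, by simpa using hb⟩)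
  exact ⟨x, hx.1, hx.2, by simpa [sub_eq_zero] using hx0⟩

/-- A crossing-free system `T` of left-to-right segments on the points of `W`, in coordinates. -/
structure IsSweepSystem {V : Type*} (W : Finset V) (T : Finset (V × V)) (X Y : V → ℝ) :
    Prop where
  injOn : Set.InjOn X W
  fst_mem : ∀ e ∈ T, e.1 ∈ W
  snd_mem : ∀ e ∈ T, e.2 ∈ W
  lt : ∀ e ∈ T, X e.1 < X e.2
  vertex : ∀ e ∈ T, ∀ u ∈ W, X e.1 < X u → X u < X e.2 → edgeHeight X Y e (X u) ≠ Y u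
  cross : ∀ e ∈ T, ∀ f ∈ T, ∀ x, X e.1 < x → x < X e.2 → X f.1 < x → x < X f.2 →
    edgeHeight X Y e x = edgeHeight X Y f x → e = f

/-- `e` passes strictly over or under the point `u`. -/
def Spans {V : Type*} (X : V → ℝ) (e : V × V) (u : V) : Prop :=
  X e.1 < X u ∧ X u < X e.2

/-- The charging relation of the sweep-line argument: an edge is charged to its right end point if
it is the steepest edge arriving there; to `(u, true)` if it is the first edge above `u`;
to `(u, false)` if it joins `u` to the right end point of the first edge below `u`. -/
def SweepCharge {V : Type*} (T : Finset (V × V)) (X Y : V → ℝ) (e : V × V) :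
    V ⊕ V × Bool → Prop
  | .inl v => e.2 = v ∧ ∀ f ∈ T, f.2 = v → edgeSlope X Y f ≤ edgeSlope X Y e
  | .inr (u, true) => Spans X e u ∧ Y u < edgeHeight X Y e (X u) ∧
      ∀ f ∈ T, Spans X f u → Y u < edgeHeight X Y f (X u) →
        edgeHeight X Y e (X u) ≤ edgeHeight X Y f (X u)
  | .inr (u, false) => e.1 = u ∧ ∃ g ∈ T, g.2 = e.2 ∧ Spans X g u ∧
      edgeHeight X Y g (X u) < Y u ∧
      ∀ f ∈ T, Spans X f u → edgeHeight X Y f (X u) < Y u →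
        edgeHeight X Y f (X u) ≤ edgeHeight X Y g (X u)

namespace IsSweepSystem

variable {V : Type*} {W : Finset V} {T : Finset (V × V)} {X Y : V → ℝ}

theorem eq_of_slope_eq (h : IsSweepSystem W T X Y) {e f : V × V} (he : e ∈ T) (hf : f ∈ T)
    (h2 : e.2 = f.2) (hs : edgeSlope X Y e = edgeSlope X Y f) : e = f := by
  have h1 := h.lt e he
  have h1' := h.lt f hf
  obtain ⟨x, hx, hx'⟩ := exists_between (max_lt h1 (h2 ▸ h1' : X f.1 < X e.2))
  refine h.cross e he f hf x ((le_max_left _ _).trans_lt hx) hx' ((le_max_right _ _).trans_lt hx)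
    (h2 ▸ hx') ?_
  simp [edgeHeight, hs, h2]

/-- Two edges at the same height over a point they both span coincide by `cross`. For a slot `(u,
false)` this makes the first edge below `u` unique, and its right end then determines the charged
edge, which starts at `u`. -/
theorem charge_unique (h : IsSweepSystem W T X Y) {e f : V × V} (he : e ∈ T) (hf : f ∈ T)
    {s : V ⊕ V × Bool} (hes : SweepCharge T X Y e s) (hfs : SweepCharge T X Y f s) : e = f := by
  rcases s with v | ⟨u, _ | _⟩
  · obtain ⟨h1, h2⟩ := hes
    obtain ⟨h3, h4⟩ := hfs
    exact h.eq_of_slope_eq he hf (h1.trans h3.symm) (le_antisymm (h4 e he h1) (h2 f hf h3))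
  · obtain ⟨h1, g, hg, hge, hgu, hgY, hgm⟩ := hes
    obtain ⟨h1', g', hg', hge', hgu', hgY', hgm'⟩ := hfs
    have hgg : g = g' := h.cross g hg g' hg' (X u) hgu.1 hgu.2 hgu'.1 hgu'.2
      (le_antisymm (hgm' g hg hgu hgY) (hgm g' hg' hgu' hgY'))
    subst hgg
    exact Prod.ext (h1.trans h1'.symm) (hge.symm.trans hge')
  · obtain ⟨h1, h2, h3⟩ := hes
    obtain ⟨h1', h2', h3'⟩ := hfs
    exact h.cross e he f hf (X u) h1.1 h1.2 h1'.1 h1'.2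
      (le_antisymm (h3 f hf h1' h2') (h3' e he h1 h2))

/-- No edge enters the wedge between two consecutive edges `g`, `e` arriving at the same point to
the right of the rightmost vertex `u` of the wedge. -/
theorem wedge_empty (h : IsSweepSystem W T X Y) {e g f : V × V} (he : e ∈ T) (hg : g ∈ T)
    (hf : f ∈ T) (hge : g.2 = e.2)
    (hmin : ∀ k ∈ T, k.2 = e.2 → edgeSlope X Y e < edgeSlope X Y k →
      edgeSlope X Y g ≤ edgeSlope X Y k)
    {u : V} (heu : X e.1 ≤ X u) (hgu : X g.1 ≤ X u) (hue : X u < X e.2)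
    (hmax : ∀ w ∈ W, X u < X w → X w < X e.2 → edgeHeight X Y g (X w) ≤ Y w →
      edgeHeight X Y e (X w) < Y w)
    (hfu : Spans X f u) (h1 : edgeHeight X Y g (X u) < edgeHeight X Y f (X u))
    (h2 : edgeHeight X Y f (X u) < edgeHeight X Y e (X u)) : False := by
  -- Over `u` the edge `f` runs strictly between `g` and `e`. Leaving through the upper side would
  -- force a crossing with `e`; `key2` is the same for the lower side `g`.
  have key1 : ∀ b, X u < b → b ≤ X f.2 → b ≤ X e.2 →
      edgeHeight X Y e b < edgeHeight X Y f b → False := by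
    intro b hb hbf hbe hh
    obtain ⟨x, hx, hx', hxx⟩ := exists_edgeHeight_eq X Y f e hb h2 hh
    have := h.cross f hf e he x (by linarith [hfu.1]) (by linarith) (by linarith) (by linarith) hxx
    subst this
    exact lt_irrefl _ h2
  have key2 : ∀ b, X u < b → b ≤ X f.2 → b ≤ X e.2 →
      edgeHeight X Y f b < edgeHeight X Y g b → False := by
    intro b hb hbf hbe hh
    obtain ⟨x, hx, hx', hxx⟩ := exists_edgeHeight_eq X Y g f hb h1 hh
    have := h.cross g hg f hf x (by linarith) (by rw [hge]; linarith) (by linarith [hfu.1])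
      (by linarith) hxx
    subst this
    exact lt_irrefl _ h1
  -- If `f` ends before the apex, its end is a vertex further right in the wedge; if it ends at the
  -- apex, its slope lies strictly between consecutive slopes; if it passes beyond, it must miss the
  -- apex above or below.
  rcases lt_trichotomy (X f.2) (X e.2) with hlt | heq | hgt
  · by_cases hq : edgeHeight X Y g (X f.2) ≤ Y f.2
    · have := hmax f.2 (h.snd_mem f hf) hfu.2 hlt hq
      exact key1 _ hfu.2 le_rfl hlt.le (by rwa [edgeHeight_snd])
    · exact key2 _ hfu.2 le_rfl hlt.le (by rw [edgeHeight_snd]; exact not_le.1 hq)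
  · have hfe : f.2 = e.2 := h.injOn (h.snd_mem f hf) (h.snd_mem e he) heq
    unfold edgeHeight at h1 h2
    rw [hge, hfe] at h1
    rw [hfe] at h2
    have hpos : 0 < X e.2 - X u := sub_pos.2 hue
    have h1' : edgeSlope X Y f < edgeSlope X Y g :=
      lt_of_mul_lt_mul_right (by linarith) hpos.le
    have h2' : edgeSlope X Y e < edgeSlope X Y f :=
      lt_of_mul_lt_mul_right (by linarith) hpos.le
    exact absurd (hmin f hf hfe h2') (not_le.2 h1')
  · have hne := h.vertex f hf e.2 (h.snd_mem e he) (by linarith [hfu.1]) hgt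
    rcases lt_or_gt_of_ne hne with hlt | hlt
    · refine key2 (X e.2) hue hgt.le le_rfl ?_
      rw [← hge, edgeHeight_snd, hge]
      exact hlt
    · refine key1 (X e.2) hue hgt.le le_rfl ?_
      rw [edgeHeight_snd]
      exact hlt

/-- An edge that is not the lowest one at its right end is charged to the rightmost vertex of the
wedge just below it. -/
theorem exists_charge (h : IsSweepSystem W T X Y) {e : V × V} (he : e ∈ T) :
    SweepCharge T X Y e (.inl e.2) ∨
      ∃ u ∈ W, ∃ b, SweepCharge T X Y e (.inr (u, b)) := by
  classical
  by_cases hs : ∀ f ∈ T, f.2 = e.2 → edgeSlope X Y f ≤ edgeSlope X Y e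
  · exact Or.inl ⟨rfl, hs⟩
  right
  push Not at hs
  obtain ⟨g0, hg0, hg02, hg0s⟩ := hs
  -- Left of the common right end, steeper means lower, so the least steeper slope gives the next
  -- edge below `e`.
  obtain ⟨g, hgm, hgmin⟩ := Finset.exists_min_image
    (T.filter fun f ↦ f.2 = e.2 ∧ edgeSlope X Y e < edgeSlope X Y f) (edgeSlope X Y)
    ⟨g0, by simp [hg0, hg02, hg0s]⟩
  simp only [Finset.mem_filter] at hgm hgmin
  obtain ⟨hg, hge, hgs⟩ := hgm
  have hle := h.lt e he
  have hlg := h.lt g hg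
  have hbelow : ∀ x, x < X e.2 → edgeHeight X Y g x < edgeHeight X Y e x := by
    intro x hx
    unfold edgeHeight
    rw [hge]
    have := mul_lt_mul_of_pos_right hgs (sub_pos.2 hx)
    linarith
  -- The wedge is taken closed, so that the later of the two left ends is a candidate.
  obtain ⟨u, hum, humax⟩ := Finset.exists_max_image
    (W.filter fun u ↦ X e.1 ≤ X u ∧ X g.1 ≤ X u ∧ X u < X e.2 ∧
      edgeHeight X Y g (X u) ≤ Y u ∧ Y u ≤ edgeHeight X Y e (X u)) X (by
    rcases le_total (X g.1) (X e.1) with hx | hx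
    · refine ⟨e.1, ?_⟩
      simp only [Finset.mem_filter]
      have := hbelow _ hle
      rw [edgeHeight_fst X Y e hle] at *
      exact ⟨h.fst_mem e he, le_rfl, hx, hle, this.le, le_rfl⟩
    · refine ⟨g.1, ?_⟩
      simp only [Finset.mem_filter]
      have hlt : X g.1 < X e.2 := by rw [← hge]; exact hlg
      have := hbelow _ hlt
      rw [edgeHeight_fst X Y g hlg] at *
      exact ⟨h.fst_mem g hg, hx, le_rfl, hlt, le_rfl, this.le⟩)
  simp only [Finset.mem_filter] at hum humax
  obtain ⟨huW, heu, hgu, hue, hug, hu_e⟩ := hum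
  have hempty : ∀ f ∈ T, Spans X f u → edgeHeight X Y g (X u) < edgeHeight X Y f (X u) →
      edgeHeight X Y e (X u) ≤ edgeHeight X Y f (X u) := by
    intro f hf hfu h1
    by_contra hcon
    refine h.wedge_empty he hg hf hge (fun k hk hk2 hks ↦ hgmin k ⟨hk, hk2, hks⟩) heu hgu hue ?_ hfu
      h1 (not_le.1 hcon)
    intro w hw huw hwe hwg
    by_contra hcon'
    exact absurd (humax w ⟨hw, heu.trans huw.le, hgu.trans huw.le, hwe, hwg, not_lt.1 hcon'⟩)
      (not_le.2 huw)
  refine ⟨u, huW, ?_⟩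
  by_cases hu : e.1 = u
  · refine ⟨false, hu, g, hg, hge, ⟨lt_of_le_of_ne hgu ?_, by rwa [hge]⟩, ?_, ?_⟩
    · intro hx
      have : g.1 = e.1 := hu ▸ h.injOn (h.fst_mem g hg) huW hx
      have : g = e := Prod.ext this hge
      subst this
      exact lt_irrefl _ hgs
    · have := hbelow _ hue
      rwa [← hu, edgeHeight_fst X Y e hle, hu] at this
    · intro f hf hfu hfY
      by_contra hcon
      have := hempty f hf hfu (not_le.1 hcon)
      rw [← hu, edgeHeight_fst X Y e hle, hu] at this
      exact absurd hfY (not_lt.2 this)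
  · have hlt : X e.1 < X u := lt_of_le_of_ne heu fun hx ↦ hu (h.injOn (h.fst_mem e he) huW hx)
    refine ⟨true, ⟨hlt, hue⟩, lt_of_le_of_ne hu_e (h.vertex e he u huW hlt hue).symm, ?_⟩
    intro f hf hfu hfY
    exact hempty f hf hfu (hug.trans_lt hfY)

/-- The height of an edge lies below every line above its end points. -/
theorem edgeHeight_le (h : IsSweepSystem W T X Y) {e : V × V} (he : e ∈ T) {m c : ℝ}
    (hm : ∀ w ∈ W, Y w - m * X w ≤ c) {x : ℝ} (h1 : X e.1 < x) (h2 : x < X e.2) :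
    edgeHeight X Y e x - m * x ≤ c := by
  have ha := hm _ (h.fst_mem e he)
  have hb := hm _ (h.snd_mem e he)
  rw [← edgeHeight_fst X Y e (h.lt e he)] at ha
  rw [← edgeHeight_snd X Y e] at hb
  unfold edgeHeight at *
  set s := edgeSlope X Y e
  rcases le_total m s with hs | hs <;> nlinarith

theorem le_edgeHeight (h : IsSweepSystem W T X Y) {e : V × V} (he : e ∈ T) {m c : ℝ}
    (hm : ∀ w ∈ W, c ≤ Y w - m * X w) {x : ℝ} (h1 : X e.1 < x) (h2 : x < X e.2) :
    c ≤ edgeHeight X Y e x - m * x := by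
  have ha := hm _ (h.fst_mem e he)
  have hb := hm _ (h.snd_mem e he)
  rw [← edgeHeight_fst X Y e (h.lt e he)] at ha
  rw [← edgeHeight_snd X Y e] at hb
  unfold edgeHeight at *
  set s := edgeSlope X Y e
  rcases le_total m s with hs | hs <;> nlinarith

/-- Some vertex other than `l` and `r` has no edge above it or no edge below it. -/
theorem exists_unused (h : IsSweepSystem W T X Y) [DecidableEq V] {l r : V}
    (hlr : X l < X r) (hne : ((W.erase l).erase r).Nonempty) :
    ∃ u ∈ (W.erase l).erase r, ∃ b, ∀ e ∈ T, ¬ SweepCharge T X Y e (.inr (u, b)) := by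
  -- `Y - m X` is, up to a constant, the height above the line through `l` and `r`.
  set m := (Y r - Y l) / (X r - X l) with hm
  have hgl : Y l - m * X l = Y r - m * X r := by
    have : X r - X l ≠ 0 := by linarith
    rw [hm]; field_simp; ring
  have hmem : ∀ w ∈ W, w ∈ (W.erase l).erase r ∨ w = l ∨ w = r := by
    intro w hw
    simp only [Finset.mem_erase]
    tauto
  obtain ⟨u, hu, humax⟩ := Finset.exists_max_image _ (fun w ↦ Y w - m * X w) hne
  -- Either the highest remaining point is not below the line `l r` and has no edge above it, or all
  -- remaining points are below that line and the lowest has no edge below it.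
  by_cases hc : Y l - m * X l ≤ Y u - m * X u
  · refine ⟨u, hu, true, fun e he hch ↦ ?_⟩
    obtain ⟨hs, hY, -⟩ := hch
    have := h.edgeHeight_le he (m := m) (c := Y u - m * X u) (fun w hw ↦ by
      rcases hmem w hw with hw | rfl | rfl
      · exact humax w hw
      · exact hc
      · exact hgl ▸ hc) hs.1 hs.2
    linarith
  · obtain ⟨v, hv, hvmin⟩ := Finset.exists_min_image _ (fun w ↦ Y w - m * X w) hne
    have hvu := humax v hv
    refine ⟨v, hv, false, fun e he hch ↦ ?_⟩
    obtain ⟨-, g, hg, -, hs, hY, -⟩ := hch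
    have := h.le_edgeHeight hg (m := m) (c := Y v - m * X v) (fun w hw ↦ by
      rcases hmem w hw with hw | rfl | rfl
      · exact hvmin w hw
      · linarith
      · linarith) hs.1 hs.2
    linarith

/-- A crossing-free system of segments on `n ≥ 3` points has at most `3n - 6` members. -/
theorem card_le (h : IsSweepSystem W T X Y) (hW : 3 ≤ W.card) : T.card + 6 ≤ 3 * W.card := by
  classical
  have hWne : W.Nonempty := Finset.card_pos.1 (by omega)
  obtain ⟨l, hl, hlmin⟩ := Finset.exists_min_image W X hWne
  obtain ⟨r, hr, hrmax⟩ := Finset.exists_max_image W X hWne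
  have hlr : l ≠ r := by
    rintro rfl
    have : W ⊆ {l} := fun w hw ↦ Finset.mem_singleton.2
      (h.injOn hw hl (le_antisymm (hrmax w hw) (hlmin w hw)))
    have := Finset.card_le_card this
    simp at this
    omega
  have hXlr : X l < X r := lt_of_le_of_ne (hlmin r hr) fun hx ↦ hlr (h.injOn hl hr hx)
  have hc1 : (W.erase l).card = W.card - 1 := Finset.card_erase_of_mem hl
  have hc2 : ((W.erase l).erase r).card = W.card - 2 := by
    rw [Finset.card_erase_of_mem (Finset.mem_erase.2 ⟨hlr.symm, hr⟩), hc1]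
    omega
  obtain ⟨u, hu, b, hub⟩ := h.exists_unused hXlr (Finset.card_pos.1 (by omega))
  have hcard := Finset.card_le_card_of_forall_subsingleton (s := T)
    (t := ((W.erase l).disjSum (((W.erase l).erase r) ×ˢ (Finset.univ : Finset Bool))).erase
      (.inr (u, b))) (SweepCharge T X Y) (by
    intro e he
    have hmin := hlmin _ (h.fst_mem e he)
    have hmax := hrmax _ (h.snd_mem e he)
    have hlt := h.lt e he
    rcases h.exists_charge he with hc | ⟨w, hw, c, hc⟩
    · refine ⟨_, ?_, hc⟩
      simp only [Finset.mem_erase, Finset.inl_mem_disjSum]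
      refine ⟨by simp, ?_, h.snd_mem e he⟩
      intro hx
      rw [hx] at hlt
      linarith
    · refine ⟨_, ?_, hc⟩
      simp only [Finset.mem_erase, Finset.inr_mem_disjSum, Finset.mem_product, Finset.mem_univ,
        and_true]
      refine ⟨fun hx ↦ hub e he (hx ▸ hc), ?_⟩
      -- Both kinds of charge at `w` need an edge passing over or under `w`, which rules out the
      -- extreme points.
      have : ∃ g ∈ T, Spans X g w := by
        cases c with
        | false => obtain ⟨-, g, hg, -, hs, -⟩ := hc; exact ⟨g, hg, hs⟩
        | true => exact ⟨e, he, hc.1⟩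
      obtain ⟨g, hg, hs1, hs2⟩ := this
      have hmin := hlmin _ (h.fst_mem g hg)
      have hmax := hrmax _ (h.snd_mem g hg)
      refine ⟨?_, ?_, hw⟩
      · rintro rfl; linarith
      · rintro rfl; linarith) (by
    intro s _ e he f hf
    exact h.charge_unique he.1 hf.1 he.2 hf.2)
  rw [Finset.card_erase_of_mem (by simpa using hu), Finset.card_disjSum, Finset.card_product, hc1,
    hc2, Finset.card_univ, Fintype.card_bool] at hcard
  omega

end IsSweepSystem

/-! ### The bound for drawings in an abstract plane -/

/-- The points `p w`, `w ∈ W`, and the segments given by the edges of `G` (all of them between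
points of `W`) form a crossing-free straight-line drawing. -/
structure IsCrossingFreeOn {V E : Type*} [AddCommGroup E] [Module ℝ E] (G : SimpleGraph V)
    (W : Finset V) (p : V → E) : Prop where
  mem : ∀ u v, G.Adj u v → u ∈ W
  injOn : Set.InjOn p W
  vertex : ∀ u v, G.Adj u v → ∀ w ∈ W, p w ∉ openSegment ℝ (p u) (p v)
  cross : ∀ u v x y, G.Adj u v → G.Adj x y → ∀ q ∈ openSegment ℝ (p u) (p v),
    q ∈ openSegment ℝ (p x) (p y) → s(u, v) = s(x, y)

/-- Turns a coincidence of heights in coordinates into a point of the drawn edge. -/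
theorem exists_mem_openSegment_edgeHeight {V E : Type*} [AddCommGroup E] [Module ℝ E] (p : V → E)
    (f g : E →ₗ[ℝ] ℝ) (e : V × V) {x : ℝ} (h1 : f (p e.1) < x) (h2 : x < f (p e.2)) :
    ∃ q ∈ openSegment ℝ (p e.1) (p e.2),
      f q = x ∧ g q = edgeHeight (fun v ↦ f (p v)) (fun v ↦ g (p v)) e x := by
  have hd : 0 < f (p e.2) - f (p e.1) := by linarith
  refine ⟨_, ⟨(f (p e.2) - x) / (f (p e.2) - f (p e.1)), (x - f (p e.1)) / (f (p e.2) - f (p e.1)),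
    div_pos (by linarith) hd, div_pos (by linarith) hd, by field_simp; ring, rfl⟩, ?_, ?_⟩
  · simp only [map_add, map_smul, smul_eq_mul]
    field_simp
    ring
  · simp only [map_add, map_smul, smul_eq_mul, edgeHeight, edgeSlope]
    field_simp
    ring

/-- A plane has two linear coordinates, the first of which separates finitely many points. -/
theorem exists_separating_coordinates {V E : Type*} [Finite V] [AddCommGroup E] [Module ℝ E]
    (A : AffineSubspace ℝ E) (hA : Module.finrank ℝ A.direction = 2) (W : Set V) (p : V → E)
    (hp : ∀ w ∈ W, p w ∈ A) (hinj : Set.InjOn p W) :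
    ∃ f g : E →ₗ[ℝ] ℝ, (∀ x ∈ A, ∀ y ∈ A, f x = f y → g x = g y → x = y) ∧
      Set.InjOn (fun v ↦ f (p v)) W := by
  have : Module.Finite ℝ A.direction := Module.finite_of_finrank_pos (by omega)
  have φ : A.direction ≃ₗ[ℝ] (Fin 2 → ℝ) := LinearEquiv.ofFinrankEq _ _ (by simp [hA])
  obtain ⟨L, hL⟩ := LinearMap.exists_extend (φ : A.direction →ₗ[ℝ] (Fin 2 → ℝ))
  have hLinj : ∀ x ∈ A, ∀ y ∈ A, L x = L y → x = y := by
    intro x hx y hy hxy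
    have hd : x - y ∈ A.direction := AffineSubspace.vsub_mem_direction hx hy
    have h1 : φ ⟨x - y, hd⟩ = L (x - y) := (LinearMap.congr_fun hL ⟨x - y, hd⟩).symm
    rw [map_sub, hxy, sub_self, LinearEquiv.map_eq_zero_iff] at h1
    simpa [sub_eq_zero] using h1
  have hfin : (Set.range fun e : V × V ↦
      -(L (p e.1) 0 - L (p e.2) 0) / (L (p e.1) 1 - L (p e.2) 1)).Finite := Set.finite_range _
  -- Shearing by `c` merges two abscissas only for one of these finitely many ratios; a pair with
  -- equal second coordinates merely excludes 0, which is harmless.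
  obtain ⟨c, hc⟩ := hfin.infinite_compl.nonempty
  refine ⟨LinearMap.proj 0 ∘ₗ L + c • (LinearMap.proj 1 ∘ₗ L), LinearMap.proj 1 ∘ₗ L, ?_, ?_⟩
  · intro x hx y hy h1 h2
    simp only [LinearMap.add_apply, LinearMap.smul_apply, LinearMap.comp_apply,
      LinearMap.proj_apply, smul_eq_mul] at h1 h2
    refine hLinj x hx y hy (funext fun i ↦ ?_)
    fin_cases i
    · simp only [Fin.zero_eta]
      rw [h2] at h1
      linarith
    · exact h2
  · intro u hu v hv huv
    simp only [LinearMap.add_apply, LinearMap.smul_apply, LinearMap.comp_apply,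
      LinearMap.proj_apply, smul_eq_mul] at huv
    have h1 : L (p u) 1 = L (p v) 1 := by
      by_contra hne
      refine hc ⟨(u, v), ?_⟩
      have : L (p u) 1 - L (p v) 1 ≠ 0 := sub_ne_zero.2 hne
      field_simp
      linarith
    refine hinj hu hv (hLinj _ (hp u hu) _ (hp v hv) (funext fun i ↦ ?_))
    fin_cases i
    · simp only [Fin.zero_eta]
      rw [h1] at huv
      linarith
    · exact h1

theorem openSegment_subset_affineSubspace {E : Type*} [AddCommGroup E] [Module ℝ E]
    (A : AffineSubspace ℝ E) {x y : E} (hx : x ∈ A) (hy : y ∈ A) :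
    openSegment ℝ x y ⊆ A :=
  A.convex.openSegment_subset hx hy

namespace IsCrossingFreeOn

variable {V E : Type*} [AddCommGroup E] [Module ℝ E] {G : SimpleGraph V} {W : Finset V} {p : V → E}

/-- A crossing-free straight-line drawing in a plane with `n ≥ 3` vertices has at most `3n - 6`
edges. -/
theorem ncard_edgeSet_le [Finite V] (h : IsCrossingFreeOn G W p) (A : AffineSubspace ℝ E)
    (hA : Module.finrank ℝ A.direction = 2) (hp : ∀ w ∈ W, p w ∈ A) (hW : 3 ≤ W.card) :
    G.edgeSet.ncard + 6 ≤ 3 * W.card := by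
  classical
  have := Fintype.ofFinite V
  obtain ⟨f, g, hfg, hf⟩ := exists_separating_coordinates A hA (W : Set V) p hp h.injOn
  let T : Finset (V × V) := {e | G.Adj e.1 e.2 ∧ f (p e.1) < f (p e.2)}
  have hT : ∀ e, e ∈ T ↔ G.Adj e.1 e.2 ∧ f (p e.1) < f (p e.2) := by simp [T]
  have hmem1 : ∀ e ∈ T, e.1 ∈ W := fun e he ↦ h.mem _ _ ((hT e).1 he).1
  have hmem2 : ∀ e ∈ T, e.2 ∈ W := fun e he ↦ h.mem _ _ ((hT e).1 he).1.symm
  have hsub : ∀ e ∈ T, openSegment ℝ (p e.1) (p e.2) ⊆ A := fun e he ↦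
    openSegment_subset_affineSubspace A (hp _ (hmem1 e he)) (hp _ (hmem2 e he))
  have hsys : IsSweepSystem W T (fun v ↦ f (p v)) (fun v ↦ g (p v)) :=
    { injOn := hf
      fst_mem := hmem1
      snd_mem := hmem2
      lt := fun e he ↦ ((hT e).1 he).2
      vertex := by
        intro e he u hu h1 h2 heq
        obtain ⟨q, hq, hfq, hgq⟩ := exists_mem_openSegment_edgeHeight p f g e h1 h2
        have := hfg q (hsub e he hq) (p u) (hp u hu) hfq (hgq.trans heq)
        exact h.vertex _ _ ((hT e).1 he).1 u hu (this ▸ hq)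
      cross := by
        intro e he e' he' x h1 h2 h1' h2' heq
        obtain ⟨q, hq, hfq, hgq⟩ := exists_mem_openSegment_edgeHeight p f g e h1 h2
        obtain ⟨q', hq', hfq', hgq'⟩ := exists_mem_openSegment_edgeHeight p f g e' h1' h2'
        have hqq := hfg q (hsub e he hq) q' (hsub e' he' hq') (hfq.trans hfq'.symm)
          (by rw [hgq, hgq', heq])
        subst hqq
        have := h.cross _ _ _ _ ((hT e).1 he).1 ((hT e').1 he').1 q hq hq'
        rcases Sym2.eq_iff.1 this with ⟨h1, h2⟩ | ⟨h1, h2⟩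
        · exact Prod.ext h1 h2
        · have ha := ((hT e).1 he).2
          have hb := ((hT e').1 he').2
          rw [h1, h2] at ha
          exact absurd ha hb.not_gt }
  have hle := hsys.card_le hW
  have : G.edgeSet ⊆ ((T.image fun e ↦ s(e.1, e.2) : Finset (Sym2 V)) : Set (Sym2 V)) := by
    intro e
    induction e with | _ u v =>
    intro huv
    rw [SimpleGraph.mem_edgeSet] at huv
    have hne : f (p u) ≠ f (p v) := fun hx ↦ huv.ne (hf (h.mem _ _ huv) (h.mem _ _ huv.symm) hx)
    simp only [Finset.coe_image, Set.mem_image, Finset.mem_coe, hT]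
    rcases lt_or_gt_of_ne hne with hlt | hlt
    · exact ⟨(u, v), ⟨huv, hlt⟩, rfl⟩
    · exact ⟨(v, u), ⟨huv.symm, hlt⟩, Sym2.eq_swap⟩
  have h1 := Set.ncard_le_ncard this (Finset.finite_toSet _)
  rw [Set.ncard_coe_finset] at h1
  have h2 := Finset.card_image_le (s := T) (f := fun e ↦ s(e.1, e.2))
  omega

end IsCrossingFreeOn

theorem SimpleGraph.ncard_edgeSet_sup {V : Type*} [Finite V] {G H : SimpleGraph V}
    (h : ∀ u v, G.Adj u v → ¬ H.Adj u v) :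
    (G ⊔ H).edgeSet.ncard = G.edgeSet.ncard + H.edgeSet.ncard := by
  rw [SimpleGraph.edgeSet_sup, Set.ncard_union_eq _ (Set.toFinite _) (Set.toFinite _)]
  rw [SimpleGraph.disjoint_edgeSet, disjoint_iff]
  ext u v
  simpa using h u v

theorem SimpleGraph.ncard_edgeSet_mono {V : Type*} [Finite V] {G H : SimpleGraph V}
    (h : G ≤ H) : G.edgeSet.ncard ≤ H.edgeSet.ncard :=
  Set.ncard_le_ncard (SimpleGraph.edgeSet_mono h) (Set.toFinite _)

/-! ### Gaps between consecutive points on the spine -/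

section Gap

variable {V E : Type*} [AddCommGroup E] [Module ℝ E]

/-- The graph joining consecutive points among the collinear points `p s`, `s ∈ S`. -/
def gapGraph (p : V → E) (S : Finset V) : SimpleGraph V where
  Adj u v := u ≠ v ∧ u ∈ S ∧ v ∈ S ∧ ∀ w ∈ S, p w ∉ openSegment ℝ (p u) (p v)
  symm := ⟨fun u v h ↦ ⟨h.1.symm, h.2.2.1, h.2.1, fun w hw ↦ by
    rw [openSegment_symm]; exact h.2.2.2 w hw⟩⟩
  loopless := ⟨fun _ h ↦ h.1 rfl⟩

/-- The points `p s`, `s ∈ S`, are distinct and lie on the line `c` at the parameters `t s`. -/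
structure IsOnLine (p : V → E) (S : Finset V) (c : ℝ →ᵃ[ℝ] E) (t : V → ℝ) : Prop where
  injective : Function.Injective c
  eq : ∀ s ∈ S, p s = c (t s)
  injOn : Set.InjOn p S

namespace IsOnLine

variable {p : V → E} {S : Finset V} {c : ℝ →ᵃ[ℝ] E} {t : V → ℝ}

theorem mem_openSegment_iff (h : IsOnLine p S c t) {u v : V} (hu : u ∈ S) (hv : v ∈ S)
    (huv : t u < t v) (q : E) :
    q ∈ openSegment ℝ (p u) (p v) ↔ ∃ x, t u < x ∧ x < t v ∧ c x = q := by
  rw [h.eq u hu, h.eq v hv, ← image_openSegment, openSegment_eq_Ioo huv]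
  simp only [Set.mem_image, Set.mem_Ioo, and_assoc]

theorem injOn_param (h : IsOnLine p S c t) : Set.InjOn t S := fun u hu v hv huv ↦
  h.injOn hu hv (by rw [h.eq u hu, h.eq v hv, huv])

theorem gap_not_between (h : IsOnLine p S c t) {u v w : V} (huv : (gapGraph p S).Adj u v)
    (hw : w ∈ S) (h1 : t u < t w) : t v ≤ t w := by
  by_contra hcon
  refine huv.2.2.2 w hw ((h.mem_openSegment_iff huv.2.1 huv.2.2.1 (h1.trans (not_le.1 hcon)) _).2 ?_)
  exact ⟨t w, h1, not_le.1 hcon, (h.eq w hw).symm⟩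

theorem exists_ordered (h : IsOnLine p S c t) {u v : V} (huv : (gapGraph p S).Adj u v) :
    ∃ x y, s(u, v) = s(x, y) ∧ (gapGraph p S).Adj x y ∧ t x < t y := by
  rcases lt_or_gt_of_ne fun hx ↦ huv.1 (h.injOn_param huv.2.1 huv.2.2.1 hx) with hlt | hlt
  · exact ⟨u, v, rfl, huv, hlt⟩
  · exact ⟨v, u, Sym2.eq_swap, huv.symm, hlt⟩

/-- Different gaps are disjoint. -/
theorem gap_cross (h : IsOnLine p S c t) {u v x y : V} (huv : (gapGraph p S).Adj u v)
    (hxy : (gapGraph p S).Adj x y) {q : E} (hq : q ∈ openSegment ℝ (p u) (p v))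
    (hq' : q ∈ openSegment ℝ (p x) (p y)) : s(u, v) = s(x, y) := by
  have hsym : ∀ {a b a' b' : V}, s(a, b) = s(a', b') →
      openSegment ℝ (p a) (p b) = openSegment ℝ (p a') (p b') := by
    intro a b a' b' hab
    rcases Sym2.eq_iff.1 hab with ⟨rfl, rfl⟩ | ⟨rfl, rfl⟩
    · rfl
    · exact openSegment_symm _ _ _
  obtain ⟨u', v', e1, huv', hlt⟩ := h.exists_ordered huv
  obtain ⟨x', y', e2, hxy', hlt'⟩ := h.exists_ordered hxy
  rw [hsym e1] at hq
  rw [hsym e2] at hq'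
  rw [e1, e2]
  obtain ⟨a, ha1, ha2, ha⟩ := (h.mem_openSegment_iff huv'.2.1 huv'.2.2.1 hlt q).1 hq
  obtain ⟨b, hb1, hb2, hb⟩ := (h.mem_openSegment_iff hxy'.2.1 hxy'.2.2.1 hlt' q).1 hq'
  obtain rfl : a = b := h.injective (ha.trans hb.symm)
  have h1 : t u' = t x' := by
    rcases lt_trichotomy (t u') (t x') with hh | hh | hh
    · have := h.gap_not_between huv' hxy'.2.1 hh
      linarith
    · exact hh
    · have := h.gap_not_between hxy' huv'.2.1 hh
      linarith
  have h2 : t v' = t y' := by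
    refine le_antisymm (h.gap_not_between huv' hxy'.2.2.1 (h1 ▸ hlt')) ?_
    exact h.gap_not_between hxy' huv'.2.2.1 (h1 ▸ hlt)
  rw [h.injOn_param huv'.2.1 hxy'.2.1 h1, h.injOn_param huv'.2.2.1 hxy'.2.2.1 h2]

/-- There is one gap fewer than there are points. -/
theorem ncard_gapGraph [Finite V] (h : IsOnLine p S c t) (hS : S.Nonempty) :
    (gapGraph p S).edgeSet.ncard + 1 = S.card := by
  classical
  have := Fintype.ofFinite V
  obtain ⟨m, hm, hmin⟩ := Finset.exists_min_image S t hS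
  have hfin : (gapGraph p S).edgeSet.Finite := Set.toFinite _
  -- A gap corresponds to its right end, so every point but the first is used exactly once; the two
  -- inequalities read this relation in opposite directions.
  let R : V → Sym2 V → Prop := fun v e ↦ ∃ u, e = s(u, v) ∧ t u < t v ∧ (gapGraph p S).Adj u v
  have h1 : (S.erase m).card ≤ hfin.toFinset.card := by
    refine Finset.card_le_card_of_forall_subsingleton R ?_ ?_
    · intro v hv
      obtain ⟨hvm, hvS⟩ := Finset.mem_erase.1 hv
      have hlt : t m < t v := lt_of_le_of_ne (hmin v hvS) fun hx ↦
        hvm (h.injOn_param hm hvS hx).symm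
      obtain ⟨u, hu, humax⟩ := Finset.exists_max_image (S.filter fun u ↦ t u < t v) t
        ⟨m, by simp [hm, hlt]⟩
      simp only [Finset.mem_filter] at hu humax
      have hadj : (gapGraph p S).Adj u v := by
        refine ⟨fun hx ↦ lt_irrefl _ (hx ▸ hu.2), hu.1, hvS, fun w hw hmem ↦ ?_⟩
        obtain ⟨x, hx1, hx2, hx⟩ := (h.mem_openSegment_iff hu.1 hvS hu.2 _).1 hmem
        rw [h.eq w hw] at hx
        have := h.injective hx
        subst this
        exact absurd (humax w ⟨hw, hx2⟩) (not_le.2 hx1)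
      exact ⟨s(u, v), by simpa using hadj, u, rfl, hu.2, hadj⟩
    · rintro e - v ⟨-, u, rfl, huv, -⟩ v' ⟨-, u', he, huv', -⟩
      rcases Sym2.eq_iff.1 he with ⟨-, h2⟩ | ⟨h2, h3⟩
      · exact h2
      · rw [h2, h3] at huv
        exact absurd huv huv'.not_gt
  have h2 : hfin.toFinset.card ≤ (S.erase m).card := by
    refine Finset.card_le_card_of_forall_subsingleton (fun e v ↦ R v e) ?_ ?_
    · intro e he
      rw [Set.Finite.mem_toFinset] at he
      induction e with | _ u v =>
      obtain ⟨x, y, he', hxy, hlt⟩ := h.exists_ordered (SimpleGraph.mem_edgeSet _ |>.1 he)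
      refine ⟨y, Finset.mem_erase.2 ⟨?_, hxy.2.2.1⟩, x, he', hlt, hxy⟩
      rintro rfl
      exact absurd (hmin x hxy.2.1) (not_le.2 hlt)
    · rintro v - e ⟨-, u, rfl, huv, hadj⟩ e' ⟨-, u', rfl, huv', hadj'⟩
      rcases lt_trichotomy (t u) (t u') with hh | hh | hh
      · exact absurd (h.gap_not_between hadj hadj'.2.1 hh) (not_le.2 huv')
      · simp only [h.injOn_param hadj.2.1 hadj'.2.1 hh]
      · exact absurd (h.gap_not_between hadj' hadj.2.1 hh) (not_le.2 huv)
  have h3 := Finset.card_erase_of_mem hm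
  have h4 := Finset.card_pos.2 hS
  rw [Set.ncard_eq_toFinset_card _ hfin]
  omega

end IsOnLine

/-- The gaps that are met by an edge of `H`. -/
def crossedGraph (p : V → E) (S : Finset V) (H : SimpleGraph V) : SimpleGraph V where
  Adj u v := (gapGraph p S).Adj u v ∧ ∃ x y, H.Adj x y ∧
    ∃ q ∈ openSegment ℝ (p x) (p y), q ∈ openSegment ℝ (p u) (p v)
  symm := ⟨fun u v h ↦ ⟨h.1.symm, by rw [openSegment_symm ℝ (p v)]; exact h.2⟩⟩
  loopless := ⟨fun _ h ↦ h.1.1 rfl⟩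

/-- The edges of `G` drawn in `A` but not in `B`. -/
def sideGraph (G : SimpleGraph V) (p : V → E) (A B : AffineSubspace ℝ E) : SimpleGraph V where
  Adj u v := G.Adj u v ∧ p u ∈ A ∧ p v ∈ A ∧ ¬ (p u ∈ B ∧ p v ∈ B)
  symm := ⟨fun _ _ h ↦ ⟨h.1.symm, h.2.2.1, h.2.1, fun h' ↦ h.2.2.2 h'.symm⟩⟩
  loopless := ⟨fun _ h ↦ h.1.ne rfl⟩

/-- The edges of `G` with both end points in `S`. -/
def inducedEdges (G : SimpleGraph V) (S : Finset V) : SimpleGraph V where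
  Adj u v := G.Adj u v ∧ u ∈ S ∧ v ∈ S
  symm := ⟨fun _ _ h ↦ ⟨h.1.symm, h.2.2, h.2.1⟩⟩
  loopless := ⟨fun _ h ↦ h.1.ne rfl⟩

end Gap

/-- An affine subspace containing two points of a segment contains its end points. -/
theorem AffineSubspace.endpoints_mem_of_two_mem {E : Type*} [AddCommGroup E] [Module ℝ E]
    (B : AffineSubspace ℝ E) {x y q q' : E} (hq : q ∈ openSegment ℝ x y)
    (hq' : q' ∈ segment ℝ x y) (hne : q ≠ q') (hqB : q ∈ B) (hqB' : q' ∈ B) : x ∈ B ∧ y ∈ B := by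
  rw [openSegment_eq_image_lineMap] at hq
  rw [segment_eq_image_lineMap] at hq'
  obtain ⟨a, -, rfl⟩ := hq
  obtain ⟨b, -, rfl⟩ := hq'
  have hab : b - a ≠ 0 := by
    intro h
    rw [sub_eq_zero] at h
    exact hne (by rw [h])
  have key : ∀ r : ℝ, AffineMap.lineMap x y r ∈ B := by
    intro r
    obtain ⟨k, hk⟩ : ∃ k, r = a + k * (b - a) := ⟨(r - a) / (b - a), by field_simp; ring⟩
    have := AffineMap.lineMap_mem k hqB hqB'
    convert this using 1
    simp only [AffineMap.lineMap_apply_module', hk]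
    module
  exact ⟨by simpa using key 0, by simpa using key 1⟩

/-! ### Counting edges in two planes -/

section TwoPlanes

variable {V E : Type*} [AddCommGroup E] [Module ℝ E] {G : SimpleGraph V} {p : V → E}
  {A B : AffineSubspace ℝ E}

theorem IsCrossingFreeOn.mono [Fintype V] (h : IsCrossingFreeOn G Finset.univ p)
    {H : SimpleGraph V} (hH : H ≤ G) {W : Finset V} (hW : ∀ u v, H.Adj u v → u ∈ W) :
    IsCrossingFreeOn H W p where
  mem := hW
  injOn := h.injOn.mono (by simp)
  vertex u v huv w _ := h.vertex u v (hH huv) w (Finset.mem_univ w)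
  cross u v x y huv hxy := h.cross u v x y (hH huv) (hH hxy)

theorem sideGraph_le (G : SimpleGraph V) (p : V → E) (A B : AffineSubspace ℝ E) :
    sideGraph G p A B ≤ G := fun _ _ h ↦ h.1

/-- The side edges have at least one of their end points off the spine. -/
theorem ncard_sideGraph_le [Fintype V] {O S : Finset V}
    (hO : ∀ v, v ∈ O ↔ p v ∈ A ∧ p v ∉ B) (hS : ∀ v, v ∈ S ↔ p v ∈ A ∧ p v ∈ B) :
    (sideGraph G p A B).edgeSet.ncard ≤ O.card * S.card + O.card.choose 2 := by
  classical
  have hsub : (sideGraph G p A B).edgeSet ⊆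
      (((O ×ˢ S).image (Function.uncurry Sym2.mk) ∪ O.offDiag.image (Function.uncurry Sym2.mk) :
        Finset (Sym2 V)) : Set (Sym2 V)) := by
    intro e
    induction e with | _ u v =>
    rintro ⟨hG, hu, hv, hB⟩
    simp only [Finset.coe_union, Finset.coe_image, Set.mem_union, Set.mem_image, Finset.mem_coe,
      Finset.mem_product, Finset.mem_offDiag, hO, hS]
    by_cases huB : p u ∈ B
    · exact Or.inl ⟨(v, u), ⟨⟨hv, fun h ↦ hB ⟨huB, h⟩⟩, hu, huB⟩, Sym2.eq_swap⟩
    · by_cases hvB : p v ∈ B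
      · exact Or.inl ⟨(u, v), ⟨⟨hu, huB⟩, hv, hvB⟩, rfl⟩
      · exact Or.inr ⟨(u, v), ⟨⟨hu, huB⟩, ⟨hv, hvB⟩, hG.ne⟩, rfl⟩
  have h1 := Set.ncard_le_ncard hsub (Finset.finite_toSet _)
  rw [Set.ncard_coe_finset] at h1
  refine h1.trans ((Finset.card_union_le _ _).trans ?_)
  rw [Sym2.card_image_offDiag]
  have := Finset.card_image_le (s := O ×ˢ S) (f := Function.uncurry Sym2.mk)
  rw [Finset.card_product] at this
  omega

/-- All edges of a drawing that lie in the plane `A`. -/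
theorem ncard_sideGraph_add_inducedEdges_le [Fintype V] (h : IsCrossingFreeOn G Finset.univ p)
    (hA : Module.finrank ℝ A.direction = 2) {W S : Finset V} (hW : ∀ v, v ∈ W ↔ p v ∈ A)
    (hS : ∀ v, v ∈ S ↔ p v ∈ A ∧ p v ∈ B) (hW3 : 3 ≤ W.card) :
    (sideGraph G p A B).edgeSet.ncard + (inducedEdges G S).edgeSet.ncard + 6 ≤ 3 * W.card := by
  rw [← SimpleGraph.ncard_edgeSet_sup]
  · refine (h.mono (W := W) (sup_le (sideGraph_le G p A B) fun _ _ (h : G.Adj _ _ ∧ _) ↦ h.1)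
      ?_).ncard_edgeSet_le A hA
      (fun w hw ↦ (hW w).1 hw) hW3
    rintro u v (huv | huv)
    · exact (hW u).2 huv.2.1
    · exact (hW u).2 ((hS u).1 huv.2.1).1
  · intro u v h1 h2
    exact h1.2.2.2 ⟨((hS u).1 h2.2.1).2, ((hS v).1 h2.2.2).2⟩

variable {S : Finset V} {c : ℝ →ᵃ[ℝ] E} {t : V → ℝ}

/-- The side edges together with the gaps they do not cross form a plane drawing. -/
theorem ncard_sideGraph_add_uncrossed_le [Fintype V] (h : IsCrossingFreeOn G Finset.univ p)
    (hA : Module.finrank ℝ A.direction = 2) {W : Finset V} (hW : ∀ v, v ∈ W ↔ p v ∈ A)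
    (hS : ∀ v, v ∈ S ↔ p v ∈ A ∧ p v ∈ B) (hc : IsOnLine p S c t) (hW3 : 3 ≤ W.card) :
    (sideGraph G p A B).edgeSet.ncard + (gapGraph p S).edgeSet.ncard + 6 ≤
      3 * W.card + (crossedGraph p S (sideGraph G p A B)).edgeSet.ncard := by
  set H := sideGraph G p A B with hH
  have hle : crossedGraph p S H ≤ gapGraph p S := fun _ _ h ↦ h.1
  have e1 : (gapGraph p S).edgeSet.ncard =
      (gapGraph p S \ crossedGraph p S H).edgeSet.ncard + (crossedGraph p S H).edgeSet.ncard := by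
    rw [← SimpleGraph.ncard_edgeSet_sup (G := gapGraph p S \ crossedGraph p S H)
      (fun u v h ↦ h.2), sdiff_sup_cancel hle]
  have e2 : (H ⊔ (gapGraph p S \ crossedGraph p S H)).edgeSet.ncard =
      H.edgeSet.ncard + (gapGraph p S \ crossedGraph p S H).edgeSet.ncard :=
    SimpleGraph.ncard_edgeSet_sup fun u v h1 h2 ↦
      h1.2.2.2 ⟨((hS u).1 h2.1.2.1).2, ((hS v).1 h2.1.2.2.1).2⟩
  have hcf : IsCrossingFreeOn (H ⊔ (gapGraph p S \ crossedGraph p S H)) W p :=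
    { mem := by
        rintro u v (huv | huv)
        · exact (hW u).2 huv.2.1
        · exact (hW u).2 ((hS u).1 huv.1.2.1).1
      injOn := h.injOn.mono (by simp)
      vertex := by
        rintro u v (huv | huv) w hw
        · exact h.vertex u v huv.1 w (Finset.mem_univ w)
        · intro hwm
          -- A vertex of `A` on a gap also lies in `B`, hence on the spine, where the gap has no
          -- interior points of `S`.
          refine huv.1.2.2.2 w ((hS w).2 ⟨(hW w).1 hw, ?_⟩) hwm
          exact openSegment_subset_affineSubspace B ((hS u).1 huv.1.2.1).2
            ((hS v).1 huv.1.2.2.1).2 hwm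
      cross := by
        rintro u v x y (huv | huv) (hxy | hxy) q hq hq'
        · exact h.cross u v x y huv.1 hxy.1 q hq hq'
        · exact absurd ⟨hxy.1, u, v, huv, q, hq, hq'⟩ hxy.2
        · exact absurd ⟨huv.1, x, y, hxy, q, hq', hq⟩ huv.2
        · exact hc.gap_cross huv.1 hxy.1 hq hq' }
  have := hcf.ncard_edgeSet_le A hA (fun w hw ↦ (hW w).1 hw) hW3
  omega

/-- The number of gaps crossed by side edges is bounded in terms of the vertices off the spine. -/
theorem ncard_crossed_le [Fintype V] (h : IsCrossingFreeOn G Finset.univ p)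
    (hA : Module.finrank ℝ A.direction = 2) {O : Finset V} (hO : ∀ v, v ∈ O ↔ p v ∈ A ∧ p v ∉ B)
    (hS : ∀ v, v ∈ S ↔ p v ∈ A ∧ p v ∈ B) (hc : IsOnLine p S c t) (hO3 : 3 ≤ O.card) :
    (crossedGraph p S (sideGraph G p A B)).edgeSet.ncard + 6 ≤ 3 * O.card := by
  set C := crossedGraph p S (sideGraph G p A B) with hC
  have hle : inducedEdges G O ≤ G := fun _ _ h ↦ h.1
  have hb := (h.mono hle fun _ _ h ↦ h.2.1).ncard_edgeSet_le A hA (fun w hw ↦ ((hO w).1 hw).1) hO3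
  have hgapB : ∀ {u v q}, (gapGraph p S).Adj u v → q ∈ openSegment ℝ (p u) (p v) → q ∈ B :=
    fun huv hq ↦ openSegment_subset_affineSubspace B ((hS _).1 huv.2.1).2
      ((hS _).1 huv.2.2.1).2 hq
  suffices hsuff : C.edgeSet.ncard ≤ (inducedEdges G O).edgeSet.ncard by omega
  have hf1 : C.edgeSet.Finite := Set.toFinite _
  have hf2 : (inducedEdges G O).edgeSet.Finite := Set.toFinite _
  rw [Set.ncard_eq_toFinset_card _ hf1, Set.ncard_eq_toFinset_card _ hf2]
  -- Each crossed gap is sent to an edge crossing it. Such an edge has both ends off `B`, since a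
  -- second point in `B` would put the whole edge there; for the same reason it meets `B` only once
  -- and serves only one gap.
  refine Finset.card_le_card_of_forall_subsingleton (fun e f ↦ ∃ u v x y, e = s(u, v) ∧
    f = s(x, y) ∧ (gapGraph p S).Adj u v ∧ G.Adj x y ∧ x ∈ O ∧
    ∃ q ∈ openSegment ℝ (p x) (p y), q ∈ openSegment ℝ (p u) (p v)) ?_ ?_
  · intro e he
    rw [Set.Finite.mem_toFinset] at he
    induction e with | _ u v =>
    obtain ⟨huv, x, y, hxy, q, hq, hq'⟩ := he
    have hqB := hgapB huv hq'
    have hne : p x ≠ p y := fun hx ↦ hxy.1.ne (h.injOn (by simp) (by simp) hx)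
    have hx : p x ∉ B := fun hx ↦ hxy.2.2.2 <|
      B.endpoints_mem_of_two_mem hq (left_mem_segment ℝ (p x) (p y))
        (fun hh ↦ h.vertex x y hxy.1 x (Finset.mem_univ x) (hh ▸ hq)) hqB hx
    have hy : p y ∉ B := fun hy ↦ hxy.2.2.2 <|
      B.endpoints_mem_of_two_mem hq (right_mem_segment ℝ (p x) (p y))
        (fun hh ↦ h.vertex x y hxy.1 y (Finset.mem_univ y) (hh ▸ hq)) hqB hy
    have hxO := (hO x).2 ⟨hxy.2.1, hx⟩
    refine ⟨s(x, y), ?_, u, v, x, y, rfl, rfl, huv, hxy.1, hxO, q, hq, hq'⟩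
    rw [Set.Finite.mem_toFinset]
    exact ⟨hxy.1, hxO, (hO y).2 ⟨hxy.2.2.1, hy⟩⟩
  · rintro f - e ⟨-, u, v, x, y, rfl, rfl, huv, hxy, hx, q, hq, hq'⟩ e'
      ⟨-, u', v', x', y', rfl, hf, huv', hxy', hx', q', hq1, hq1'⟩
    have hq1x : q' ∈ openSegment ℝ (p x) (p y) := by
      rcases Sym2.eq_iff.1 hf with ⟨rfl, rfl⟩ | ⟨rfl, rfl⟩
      · exact hq1
      · rw [openSegment_symm]; exact hq1
    have hqq : q = q' := by
      by_contra hne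
      exact ((hO x).1 hx).2 (B.endpoints_mem_of_two_mem hq (openSegment_subset_segment ℝ _ _ hq1x)
        hne (hgapB huv hq') (hgapB huv' hq1')).1
    subst hqq
    exact hc.gap_cross huv huv' hq' hq1'

/-- Gaps crossed by an edge are not edges themselves. -/
theorem ncard_inducedEdges_add_crossed_le [Fintype V] (h : IsCrossingFreeOn G Finset.univ p)
    (hS : ∀ v, v ∈ S ↔ p v ∈ A ∧ p v ∈ B) :
    (inducedEdges G S).edgeSet.ncard + (crossedGraph p S (sideGraph G p A B)).edgeSet.ncard ≤
      (gapGraph p S).edgeSet.ncard := by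
  rw [← SimpleGraph.ncard_edgeSet_sup]
  · refine SimpleGraph.ncard_edgeSet_mono (sup_le ?_ fun _ _ h ↦ h.1)
    exact fun u v huv ↦ ⟨huv.1.ne, huv.2.1, huv.2.2,
      fun w _ ↦ h.vertex u v huv.1 w (Finset.mem_univ w)⟩
  · rintro u v huv ⟨-, x, y, hxy, q, hq, hq'⟩
    have := h.cross u v x y huv.1 hxy.1 q hq' hq
    rcases Sym2.eq_iff.1 this with ⟨rfl, rfl⟩ | ⟨rfl, rfl⟩
    · exact hxy.2.2.2 ⟨((hS _).1 huv.2.1).2, ((hS _).1 huv.2.2).2⟩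
    · exact hxy.2.2.2 ⟨((hS _).1 huv.2.2).2, ((hS _).1 huv.2.1).2⟩

/-- A drawing in two planes that meet in at most a line has at most `5n - 19` edges. -/
theorem ncard_edgeSet_add_le_of_two_planes [Fintype V] (h : IsCrossingFreeOn G Finset.univ p)
    (hA : Module.finrank ℝ A.direction = 2) (hB : Module.finrank ℝ B.direction = 2)
    (hc : Function.Injective c) (hAB : ∀ x ∈ A, x ∈ B → ∃ r, c r = x)
    (hp : ∀ v, p v ∈ A ∨ p v ∈ B)
    (hG : ∀ u v, G.Adj u v → (p u ∈ A ∧ p v ∈ A) ∨ (p u ∈ B ∧ p v ∈ B))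
    (hn : 7 ≤ Fintype.card V) : G.edgeSet.ncard + 19 ≤ 5 * Fintype.card V := by
  classical
  obtain ⟨S, hS⟩ : ∃ S : Finset V, ∀ v, v ∈ S ↔ p v ∈ A ∧ p v ∈ B :=
    ⟨Finset.univ.filter fun v ↦ p v ∈ A ∧ p v ∈ B, by simp⟩
  obtain ⟨OA, hOA⟩ : ∃ S : Finset V, ∀ v, v ∈ S ↔ p v ∈ A ∧ p v ∉ B :=
    ⟨Finset.univ.filter fun v ↦ p v ∈ A ∧ p v ∉ B, by simp⟩
  obtain ⟨OB, hOB⟩ : ∃ S : Finset V, ∀ v, v ∈ S ↔ p v ∈ B ∧ p v ∉ A :=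
    ⟨Finset.univ.filter fun v ↦ p v ∈ B ∧ p v ∉ A, by simp⟩
  have hS' : ∀ v, v ∈ S ↔ p v ∈ B ∧ p v ∈ A := fun v ↦ (hS v).trans and_comm
  have hdA : Disjoint S OA := Finset.disjoint_left.2 fun v h1 h2 ↦
    ((hOA v).1 h2).2 ((hS v).1 h1).2
  have hdB : Disjoint S OB := Finset.disjoint_left.2 fun v h1 h2 ↦
    ((hOB v).1 h2).2 ((hS v).1 h1).1
  have hdAB : Disjoint (S ∪ OA) OB := Finset.disjoint_left.2 fun v h1 h2 ↦ by
    simp only [Finset.mem_union, hS, hOA, hOB] at h1 h2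
    tauto
  have hWA : ∀ v, v ∈ S ∪ OA ↔ p v ∈ A := fun v ↦ by
    simp only [Finset.mem_union, hS, hOA]; tauto
  have hWB : ∀ v, v ∈ S ∪ OB ↔ p v ∈ B := fun v ↦ by
    simp only [Finset.mem_union, hS, hOB]; tauto
  have hcA := Finset.card_union_of_disjoint hdA
  have hcB := Finset.card_union_of_disjoint hdB
  have hcn : S.card + OA.card + OB.card = Fintype.card V := by
    rw [← hcA, ← Finset.card_union_of_disjoint hdAB, ← Finset.card_univ]
    congr 1
    ext v
    have := hp v
    simp only [Finset.mem_union, hS, hOA, hOB, Finset.mem_univ, iff_true]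
    tauto
  have ht : ∀ v, ∃ r, v ∈ S → p v = c r := fun v ↦ by
    by_cases hv : v ∈ S
    · obtain ⟨r, hr⟩ := hAB _ ((hS v).1 hv).1 ((hS v).1 hv).2
      exact ⟨r, fun _ ↦ hr.symm⟩
    -- Off the spine the parameter is a dummy value.
    · exact ⟨0, fun hv' ↦ absurd hv' hv⟩
  choose t ht using ht
  have hline : IsOnLine p S c t := ⟨hc, ht, h.injOn.mono (by simp)⟩
  have hE : G.edgeSet.ncard ≤ (sideGraph G p A B).edgeSet.ncard +
      (sideGraph G p B A).edgeSet.ncard + (inducedEdges G S).edgeSet.ncard := by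
    have hle : G ≤ sideGraph G p A B ⊔ sideGraph G p B A ⊔ inducedEdges G S := by
      intro u v huv
      by_cases hs : u ∈ S ∧ v ∈ S
      · exact Or.inr ⟨huv, hs⟩
      · rw [hS, hS] at hs
        left
        rcases hG u v huv with hh | hh
        · exact Or.inl ⟨huv, hh.1, hh.2, by tauto⟩
        · exact Or.inr ⟨huv, hh.1, hh.2, by tauto⟩
    refine (SimpleGraph.ncard_edgeSet_mono hle).trans ?_
    rw [SimpleGraph.edgeSet_sup, SimpleGraph.edgeSet_sup]
    exact (Set.ncard_union_le _ _).trans (Nat.add_le_add_right (Set.ncard_union_le _ _) _)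
  have sA := ncard_sideGraph_le (G := G) hOA hS
  have sB := ncard_sideGraph_le (G := G) hOB hS'
  have pA := ncard_sideGraph_add_inducedEdges_le h hA hWA hS
  have pB := ncard_sideGraph_add_inducedEdges_le h hB hWB hS'
  have uA := ncard_sideGraph_add_uncrossed_le h hA hWA hS hline
  have uB := ncard_sideGraph_add_uncrossed_le h hB hWB hS' hline
  have cA := ncard_crossed_le h hA hOA hS hline
  have cB := ncard_crossed_le h hB hOB hS' hline
  have iA := ncard_inducedEdges_add_crossed_le h hS
  have iB := ncard_inducedEdges_add_crossed_le h hS'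
  have hK := hline.ncard_gapGraph
  rw [hcA] at pA uA
  rw [hcB] at pB uB
  have hK' : S.card = 0 ∨ (gapGraph p S).edgeSet.ncard + 1 = S.card := by
    rcases S.eq_empty_or_nonempty with hS0 | hS0
    · exact Or.inl (by simp [hS0])
    · exact Or.inr (hK hS0)
  have hsmall : ∀ a : ℕ, a < 3 → a = 0 ∨ a = 1 ∨ a = 2 := by omega
  -- With both sides large, the gap estimates are needed. Otherwise a small side has at most 0, `s`
  -- or `2s + 1` edges. If a side is empty, the plane bound `3n - 6` suffices because `n ≥ 7`; sides
  -- of two points each attain `5n - 19`.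
  by_cases hA3 : 3 ≤ OA.card
  · by_cases hB3 : 3 ≤ OB.card
    · have := uA (by omega)
      have := uB (by omega)
      have := cA hA3
      have := cB hB3
      omega
    · have := pA (by omega)
      rcases hsmall _ (not_le.1 hB3) with hb | hb | hb <;> simp [hb] at sB <;> omega
  · rcases hsmall _ (not_le.1 hA3) with ha | ha | ha <;> simp [ha] at sA
    · have := pB (by omega)
      omega
    · by_cases hb0 : OB.card = 0
      · have := pA (by omega)
        simp [hb0] at sB
        omega
      by_cases hb1 : OB.card = 1
      · simp [hb1] at sB
        omega
      have := pB (by omega)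
      omega
    · by_cases hb0 : OB.card = 0
      · have := pA (by omega)
        simp [hb0] at sB
        omega
      by_cases hb1 : OB.card = 1
      · have := pA (by omega)
        simp [hb1] at sB
        omega
      have := pB (by omega)
      omega

end TwoPlanes

/-! ### From drawings and the cover number to two planes -/

/-- The common points of two distinct planes lie on a line. -/
theorem AffineSubspace.exists_line_of_planes_ne {E : Type*} [AddCommGroup E] [Module ℝ E]
    {A B : AffineSubspace ℝ E} (hA : Module.finrank ℝ A.direction = 2)
    (hB : Module.finrank ℝ B.direction = 2) (hAB : A ≠ B) :
    ∃ c : ℝ →ᵃ[ℝ] E, Function.Injective c ∧ ∀ x ∈ A, x ∈ B → ∃ r, c r = x := by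
  have fA : Module.Finite ℝ A.direction := Module.finite_of_finrank_pos (by omega)
  have fB : Module.Finite ℝ B.direction := Module.finite_of_finrank_pos (by omega)
  have hnt : Nontrivial A.direction := Module.nontrivial_of_finrank_pos (R := ℝ) (by omega)
  obtain ⟨⟨v₀, hv₀A⟩, hne⟩ := exists_ne (0 : A.direction)
  have hv₀ : v₀ ≠ 0 := fun h ↦ hne (Subtype.ext h)
  by_cases hq : ∃ q, q ∈ A ∧ q ∈ B
  · obtain ⟨q, hqA, hqB⟩ := hq
    have hle : Module.finrank ℝ ↥(A.direction ⊓ B.direction) ≤ 1 := by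
      by_contra hcon
      have hd1 : A.direction ⊓ B.direction = A.direction :=
        Submodule.eq_of_le_of_finrank_le inf_le_left (by omega)
      have hd2 : A.direction ⊓ B.direction = B.direction :=
        Submodule.eq_of_le_of_finrank_le inf_le_right (by omega)
      exact hAB (AffineSubspace.ext_of_direction_eq (hd1.symm.trans hd2) ⟨q, hqA, hqB⟩)
    have fD : Module.Finite ℝ ↥(A.direction ⊓ B.direction) :=
      Submodule.finiteDimensional_inf_left _ _
    obtain ⟨⟨v, hv⟩, hspan⟩ := finrank_le_one_iff.1 hle
    obtain ⟨w, hw0, hw⟩ : ∃ w : E, w ≠ 0 ∧ ∀ x ∈ A.direction ⊓ B.direction, ∃ r : ℝ, r • w = x := by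
      -- The planes may share a single point; an arbitrary nonzero direction then keeps the line
      -- injective.
      by_cases hv0 : v = 0
      · refine ⟨v₀, hv₀, fun x hx ↦ ⟨0, ?_⟩⟩
        obtain ⟨r, hr⟩ := hspan ⟨x, hx⟩
        have := congrArg Subtype.val hr
        simp only [SetLike.mk_smul_mk, hv0, smul_zero] at this
        rw [zero_smul, ← this]
      · refine ⟨v, hv0, fun x hx ↦ ?_⟩
        obtain ⟨r, hr⟩ := hspan ⟨x, hx⟩
        exact ⟨r, congrArg Subtype.val hr⟩
    refine ⟨AffineMap.lineMap q (q + w), AffineMap.lineMap_injective ℝ (by simpa using hw0),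
      fun x hxA hxB ↦ ?_⟩
    obtain ⟨r, hr⟩ := hw (x - q) ⟨AffineSubspace.vsub_mem_direction hxA hqA,
      AffineSubspace.vsub_mem_direction hxB hqB⟩
    refine ⟨r, ?_⟩
    rw [AffineMap.lineMap_apply_module', add_sub_cancel_left, hr, sub_add_cancel]
  · exact ⟨AffineMap.lineMap 0 v₀, AffineMap.lineMap_injective ℝ hv₀.symm,
      fun x hxA hxB ↦ absurd ⟨x, hxA, hxB⟩ hq⟩

/-- A segment with end points and midpoint in the union of two affine subspaces lies in one of
them. -/
theorem AffineSubspace.endpoints_mem_of_segment_subset_union {E : Type*} [AddCommGroup E]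
    [Module ℝ E] {A B : AffineSubspace ℝ E} {x y : E}
    (h : segment ℝ x y ⊆ (A : Set E) ∪ B) : (x ∈ A ∧ y ∈ A) ∨ (x ∈ B ∧ y ∈ B) := by
  by_cases hxy : x = y
  · subst hxy
    have := h (left_mem_segment ℝ x x)
    simpa using this
  have hx := h (left_mem_segment ℝ x y)
  have hm : AffineMap.lineMap x y (1 / 2 : ℝ) ∈ openSegment ℝ x y := by
    rw [openSegment_eq_image_lineMap]
    exact ⟨1 / 2, by norm_num, rfl⟩
  have hne : AffineMap.lineMap x y (1 / 2 : ℝ) ≠ x := by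
    intro hh
    rw [AffineMap.lineMap_eq_left_iff] at hh
    rcases hh with hh | hh
    · exact hxy hh
    · norm_num at hh
  have hne' : AffineMap.lineMap x y (1 / 2 : ℝ) ≠ y := by
    intro hh
    rw [AffineMap.lineMap_eq_right_iff] at hh
    rcases hh with hh | hh
    · exact hxy hh
    · norm_num at hh
  have hy := h (right_mem_segment ℝ x y)
  rcases h (openSegment_subset_segment ℝ x y hm) with hmA | hmB
  · rcases hx with hx | hx
    · exact Or.inl (A.endpoints_mem_of_two_mem hm (left_mem_segment ℝ x y) hne hmA hx)
    · rcases hy with hy | hy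
      · exact Or.inl (A.endpoints_mem_of_two_mem hm (right_mem_segment ℝ x y) hne' hmA hy)
      · exact Or.inr ⟨hx, hy⟩
  · rcases hx with hx | hx
    · rcases hy with hy | hy
      · exact Or.inl ⟨hx, hy⟩
      · exact Or.inr (B.endpoints_mem_of_two_mem hm (right_mem_segment ℝ x y) hne' hmB hy)
    · exact Or.inr (B.endpoints_mem_of_two_mem hm (left_mem_segment ℝ x y) hne hmB hx)

namespace StraightLineDrawing

variable {V : Type*} {G : SimpleGraph V} {d : ℕ} (D : StraightLineDrawing G d)

theorem isCrossingFreeOn [Fintype V] : IsCrossingFreeOn G Finset.univ D.pos where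
  mem _ _ _ := Finset.mem_univ _
  injOn := D.pos_injective.injOn
  vertex u v huv w _ := D.vertex_notMem_edge u v w huv
  cross u v x y huv hxy q hq hq' := by
    by_contra hne
    exact Set.disjoint_left.1 (D.edges_disjoint u v x y huv hxy hne) hq hq'

theorem pos_mem_carrier (v : V) : D.pos v ∈ D.carrier := Or.inl ⟨v, rfl⟩

theorem segment_subset_carrier {u v : V} (h : G.Adj u v) :
    segment ℝ (D.pos u) (D.pos v) ⊆ D.carrier := fun _ hq ↦ Or.inr ⟨u, v, h, hq⟩

theorem ncard_edgeSet_le_of_two_planes [Fintype V]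
    {A B : AffineSubspace ℝ (EuclideanSpace ℝ (Fin d))} (hA : IsFlat 2 A) (hB : IsFlat 2 B)
    (hAB : A ≠ B) (hD : D.carrier ⊆ (A : Set (EuclideanSpace ℝ (Fin d))) ∪ B)
    (hn : 7 ≤ Fintype.card V) : G.edgeSet.ncard + 19 ≤ 5 * Fintype.card V := by
  obtain ⟨c, hc, hl⟩ := AffineSubspace.exists_line_of_planes_ne hA.2 hB.2 hAB
  exact ncard_edgeSet_add_le_of_two_planes D.isCrossingFreeOn hA.2 hB.2 hc hl
    (fun v ↦ hD (D.pos_mem_carrier v))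
    (fun u v huv ↦ AffineSubspace.endpoints_mem_of_segment_subset_union
      ((D.segment_subset_carrier huv).trans hD)) hn

theorem ncard_edgeSet_le_of_plane [Fintype V]
    {A : AffineSubspace ℝ (EuclideanSpace ℝ (Fin d))} (hA : IsFlat 2 A)
    (hD : D.carrier ⊆ (A : Set (EuclideanSpace ℝ (Fin d))))
    (hn : 3 ≤ Fintype.card V) : G.edgeSet.ncard + 6 ≤ 3 * Fintype.card V :=
  D.isCrossingFreeOn.ncard_edgeSet_le A hA.2 (fun v _ ↦ hD (D.pos_mem_carrier v)) hn

end StraightLineDrawing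

theorem exists_two_planes_of_strongPlaneCoverNumber_eq {V : Type*} {G : SimpleGraph V}
    (h : strongPlaneCoverNumber G = 2) :
    ∃ A B : AffineSubspace ℝ (EuclideanSpace ℝ (Fin 3)), IsFlat 2 A ∧ IsFlat 2 B ∧ A ≠ B ∧
      ∃ D : StraightLineDrawing G 3,
        D.carrier ⊆ (A : Set (EuclideanSpace ℝ (Fin 3))) ∪ B := by
  obtain ⟨K, hK, hKP⟩ : ∃ K : Set ℕ∞, sInf K = strongPlaneCoverNumber G ∧
      ∀ k ∈ K, ∃ P : Set (AffineSubspace ℝ (EuclideanSpace ℝ (Fin 3))),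
        (∀ A ∈ P, IsFlat 2 A) ∧ P.encard = k ∧ ∃ D : StraightLineDrawing G 3,
          D.carrier ⊆ ⋃ A ∈ P, (A : Set (EuclideanSpace ℝ (Fin 3))) :=
    ⟨_, rfl, fun _ h ↦ h⟩
  rw [h] at hK
  have hne : K.Nonempty := by
    rw [Set.nonempty_iff_ne_empty]
    rintro rfl
    rw [sInf_empty] at hK
    exact absurd hK (by decide)
  -- A nonempty set in the well-ordered `ℕ∞` attains its infimum.
  obtain ⟨P, hP, hcard, D, hD⟩ := hKP _ (hK ▸ csInf_mem hne)
  obtain ⟨A, B, hAB, rfl⟩ := Set.encard_eq_two.1 hcard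
  refine ⟨A, B, hP A (by simp), hP B (by simp), hAB, D, ?_⟩
  simpa using hD

/-- A graph with too many edges for one plane that is drawn in two planes. -/
theorem strongPlaneCoverNumber_eq_two {V : Type*} [Fintype V] {G : SimpleGraph V}
    (hn : 3 ≤ Fintype.card V) (hG : 3 * Fintype.card V < G.edgeSet.ncard + 6)
    {A B : AffineSubspace ℝ (EuclideanSpace ℝ (Fin 3))} (hA : IsFlat 2 A) (hB : IsFlat 2 B)
    (D : StraightLineDrawing G 3)
    (hD : D.carrier ⊆ (A : Set (EuclideanSpace ℝ (Fin 3))) ∪ B) :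
    strongPlaneCoverNumber G = 2 := by
  have hAB : A ≠ B := by
    rintro rfl
    rw [Set.union_self] at hD
    have := D.ncard_edgeSet_le_of_plane hA hD hn
    omega
  refine le_antisymm (sInf_le ⟨{A, B}, ?_, Set.encard_pair hAB, D, by simpa using hD⟩)
    (le_sInf ?_)
  · rintro C (rfl | rfl)
    exacts [hA, hB]
  · rintro k ⟨P, hP, rfl, D', hD'⟩
    by_contra hcon
    have hle : P.encard ≤ 1 := by
      rw [not_le] at hcon
      exact Order.le_of_lt_add_one (by simpa [one_add_one_eq_two] using hcon)
    rcases Set.encard_le_one_iff_eq.1 hle with rfl | ⟨C, rfl⟩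
    · obtain ⟨v⟩ : Nonempty V := Fintype.card_pos_iff.1 (by omega)
      simpa using hD' (D'.pos_mem_carrier v)
    · have := D'.ncard_edgeSet_le_of_plane (hP C rfl) (by simpa using hD') hn
      omega

/-! ### The extremal example -/

section SpineGraph

/-- The edges of the spine graph: path edges, edges between path and apices, and one edge for each
plane. -/
def spineEdge (m : ℕ) : Fin m ⊕ (Fin (m + 1) × (Bool × Bool)) ⊕ Bool →
    Sym2 (Fin (m + 1) ⊕ (Bool × Bool))
  | .inl i => s(.inl i.castSucc, .inl i.succ)
  | .inr (.inl (i, x)) => s(.inl i, .inr x)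
  | .inr (.inr c) => s(.inr (c, false), .inr (c, true))

theorem spineEdge_injective (m : ℕ) : Function.Injective (spineEdge m) := by
  rintro (i | ⟨i, x⟩ | c) (j | ⟨j, y⟩ | d) h
  · simp only [spineEdge, Sym2.eq_iff, Sum.inl.injEq, Fin.ext_iff, Fin.val_castSucc,
      Fin.val_succ] at h
    simp only [Sum.inl.injEq, Fin.ext_iff]
    omega
  · simp [spineEdge] at h
  · simp [spineEdge] at h
  · simp [spineEdge] at h
  · simpa [spineEdge] using h
  · simp [spineEdge] at h
  · simp [spineEdge] at h
  · simp [spineEdge] at h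
  · simpa [spineEdge] using h

theorem exists_spineEdge_eq {m : ℕ} {u v : Fin (m + 1) ⊕ (Bool × Bool)}
    (h : (spineGraph (m + 1)).Adj u v) : ∃ e, spineEdge m e = s(u, v) := by
  rcases u with i | ⟨c, a⟩ <;> rcases v with j | ⟨d, b⟩
  · rcases SimpleGraph.pathGraph_adj.1 (show (SimpleGraph.pathGraph (m + 1)).Adj i j from h) with
      hij | hij
    · refine ⟨.inl ⟨i, by omega⟩, ?_⟩
      simp [spineEdge, hij]
    · refine ⟨.inl ⟨j, by omega⟩, ?_⟩
      rw [Sym2.eq_swap]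
      simp [spineEdge, hij]
  · exact ⟨.inr (.inl (i, _)), rfl⟩
  · exact ⟨.inr (.inl (j, _)), Sym2.eq_swap⟩
  · obtain ⟨rfl, hab⟩ : c = d ∧ a ≠ b := h
    refine ⟨.inr (.inr c), ?_⟩
    cases a <;> cases b <;> simp_all [spineEdge]

theorem spineEdge_mem_edgeSet {m : ℕ} (e : Fin m ⊕ (Fin (m + 1) × (Bool × Bool)) ⊕ Bool) :
    spineEdge m e ∈ (spineGraph (m + 1)).edgeSet := by
  rcases e with i | ⟨i, x⟩ | c
  · exact SimpleGraph.pathGraph_adj.2 (Or.inl (by simp))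
  · trivial
  · exact ⟨rfl, by simp⟩

theorem ncard_edgeSet_spineGraph (m : ℕ) :
    (spineGraph (m + 1)).edgeSet.ncard = 5 * m + 6 := by
  have : (spineGraph (m + 1)).edgeSet = Set.range (spineEdge m) := by
    ext e
    refine ⟨?_, ?_⟩
    · induction e with | _ u v =>
      exact exists_spineEdge_eq
    · rintro ⟨e, rfl⟩
      exact spineEdge_mem_edgeSet e
  rw [this, ← Set.image_univ, Set.ncard_image_of_injective _ (spineEdge_injective m),
    Set.ncard_univ, Nat.card_eq_fintype_card]
  simp only [Fintype.card_sum, Fintype.card_prod, Fintype.card_fin, Fintype.card_bool]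
  omega

/-- The position of a vertex of the spine graph. -/
noncomputable def spinePos (k : ℕ) : Fin k ⊕ (Bool × Bool) → EuclideanSpace ℝ (Fin 3)
  | .inl i => !₂[(i : ℝ) + 1, 0, 0]
  | .inr (false, h) => !₂[0, cond h 1 (-1), 0]
  | .inr (true, h) => !₂[-1, 0, cond h 1 (-1)]

/-- The coordinates of a point in the interior of an edge of the spine graph. -/
def SpineEdgePoint (m : ℕ) (x y z : ℝ) :
    Fin m ⊕ (Fin (m + 1) × (Bool × Bool)) ⊕ Bool → Prop
  | .inl i => (i : ℝ) + 1 < x ∧ x < i + 2 ∧ y = 0 ∧ z = 0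
  | .inr (.inl (i, (false, h))) => 0 < x ∧ 0 < cond h y (-y) ∧ cond h y (-y) < 1 ∧
      x = (1 - cond h y (-y)) * (i + 1) ∧ z = 0
  | .inr (.inl (i, (true, h))) => -1 < x ∧ 0 < cond h z (-z) ∧ cond h z (-z) < 1 ∧
      x = (1 - cond h z (-z)) * (i + 1) - cond h z (-z) ∧ y = 0
  | .inr (.inr false) => x = 0 ∧ -1 < y ∧ y < 1 ∧ z = 0
  | .inr (.inr true) => x = -1 ∧ y = 0 ∧ -1 < z ∧ z < 1

/-- On a spoke, the absolute value of the off-spine coordinate is the weight of the apex, which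
fixes the formula for the first coordinate. -/
theorem spineEdgePoint_of_mem {m : ℕ} {u v : Fin (m + 1) ⊕ (Bool × Bool)}
    {e : Fin m ⊕ (Fin (m + 1) × (Bool × Bool)) ⊕ Bool} (he : spineEdge m e = s(u, v))
    {q : EuclideanSpace ℝ (Fin 3)}
    (hq : q ∈ openSegment ℝ (spinePos (m + 1) u) (spinePos (m + 1) v)) :
    SpineEdgePoint m (q 0) (q 1) (q 2) e := by
  have key : ∀ a b, s(a, b) = s(u, v) →
      q ∈ openSegment ℝ (spinePos (m + 1) a) (spinePos (m + 1) b) := by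
    intro a b hab
    rcases Sym2.eq_iff.1 hab with ⟨rfl, rfl⟩ | ⟨rfl, rfl⟩
    · exact hq
    · rw [openSegment_symm]; exact hq
  have hpos : ∀ {n : ℕ} (i : Fin n), (0 : ℝ) ≤ i := fun i ↦ Nat.cast_nonneg _
  rcases e with i | ⟨i, ⟨_ | _, _ | _⟩⟩ | _ | _ <;>
    obtain ⟨s, t, hs, ht, hst, rfl⟩ := key _ _ he <;>
    simp only [SpineEdgePoint, spinePos, PiLp.add_apply, PiLp.smul_apply, smul_eq_mul,
      Matrix.cons_val_zero, Matrix.cons_val_one, Matrix.cons_val, mul_zero, zero_add,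
      add_zero, Fin.val_castSucc, Fin.val_succ, and_true, cond_true, cond_false] <;>
    obtain rfl : t = 1 - s := by linarith
  · push_cast
    constructor <;> nlinarith
  · have := mul_pos hs (by linarith [hpos i] : (0 : ℝ) < i + 1)
    refine ⟨this, ?_, ?_, ?_⟩ <;> linarith
  · have := mul_pos hs (by linarith [hpos i] : (0 : ℝ) < i + 1)
    refine ⟨this, ?_, ?_, ?_⟩ <;> linarith
  · have := mul_pos hs (by linarith [hpos i] : (0 : ℝ) < i + 1)
    refine ⟨?_, ?_, ?_, ?_⟩ <;> linarith
  · have := mul_pos hs (by linarith [hpos i] : (0 : ℝ) < i + 1)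
    refine ⟨?_, ?_, ?_, ?_⟩ <;> linarith
  · refine ⟨trivial, ?_, ?_⟩ <;> linarith
  · refine ⟨by linarith, trivial, ?_, ?_⟩ <;> linarith

theorem Fin.eq_of_cast_lt {n : ℕ} {i j : Fin n} (h1 : (i : ℝ) < j + 1) (h2 : (j : ℝ) < i + 1) :
    i = j := by
  have h1' : (i : ℕ) < j + 1 := by exact_mod_cast h1
  have h2' : (j : ℕ) < i + 1 := by exact_mod_cast h2
  exact Fin.ext (by omega)

/-- The edges joining opposite apices meet the spine at abscissas 0 and -1, away from each other and
left of the path, which starts at 1. Spokes in different half-planes are separated by signs, and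
spokes from one apex meet only there. -/
theorem spineEdgePoint_unique {m : ℕ} {x y z : ℝ}
    {e f : Fin m ⊕ (Fin (m + 1) × (Bool × Bool)) ⊕ Bool} (he : SpineEdgePoint m x y z e)
    (hf : SpineEdgePoint m x y z f) : e = f := by
  have hfac : ∀ {n : ℕ} {i j : Fin n} {r : ℝ}, r < 1 →
      (1 - r) * ((i : ℝ) + 1) = (1 - r) * (j + 1) → i = j := by
    intro n i j r hr h
    have := mul_left_cancel₀ (by linarith : 1 - r ≠ 0) h
    exact Fin.ext (by exact_mod_cast add_right_cancel this)
  rcases e with i | ⟨i, ⟨_ | _, _ | _⟩⟩ | _ | _ <;> rcases f with j | ⟨j, ⟨_ | _, _ | _⟩⟩ | _ | _ <;>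
    simp only [SpineEdgePoint, cond_true, cond_false] at he hf <;> casesm* _ ∧ _
  -- Different kinds of edges contradict each other linearly; path edges agree by rounding, and
  -- spokes of one apex by cancelling the nonzero weight of the path vertex.
  all_goals first
    | rfl
    | (exfalso; linarith)
    | (rw [Fin.eq_of_cast_lt (i := i) (j := j) (by linarith) (by linarith)])
    | (rw [hfac (by assumption) (by linarith : (1 - y) * ((i : ℝ) + 1) = (1 - y) * (j + 1))])
    | (rw [hfac (by assumption) (by linarith : (1 - -y) * ((i : ℝ) + 1) = (1 - -y) * (j + 1))])
    | (rw [hfac (by assumption) (by linarith : (1 - z) * ((i : ℝ) + 1) = (1 - z) * (j + 1))])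
    | (rw [hfac (by assumption) (by linarith : (1 - -z) * ((i : ℝ) + 1) = (1 - -z) * (j + 1))])

theorem spinePos_notMem {m : ℕ} {q : EuclideanSpace ℝ (Fin 3)}
    {e : Fin m ⊕ (Fin (m + 1) × (Bool × Bool)) ⊕ Bool} (he : SpineEdgePoint m (q 0) (q 1) (q 2) e)
    (w : Fin (m + 1) ⊕ (Bool × Bool)) : spinePos (m + 1) w ≠ q := by
  have hpos : ∀ {n : ℕ} (i : Fin n), (0 : ℝ) ≤ i := fun i ↦ Nat.cast_nonneg _
  rintro rfl
  rcases e with i | ⟨i, ⟨_ | _, _ | _⟩⟩ | _ | _ <;> rcases w with j | ⟨_ | _, _ | _⟩ <;>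
    simp only [SpineEdgePoint, spinePos, Matrix.cons_val_zero, Matrix.cons_val_one,
      Matrix.cons_val, cond_true, cond_false] at he <;> casesm* _ ∧ _
  all_goals first
    | linarith
    | linarith [hpos i]
    | linarith [hpos j]
    -- No integer lies strictly between consecutive path positions.
    | exact Nat.not_lt_of_le (Nat.lt_succ_iff.1 (by
        rw [← Nat.cast_lt (α := ℝ)]; push_cast; linarith : (j : ℕ) < i + 1)) (by
        rw [← Nat.cast_lt (α := ℝ)]; linarith)

theorem spinePos_injective (k : ℕ) : Function.Injective (spinePos k) := by
  intro u v h
  have h0 := congrFun (congrArg WithLp.ofLp h) 0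
  have h1 := congrFun (congrArg WithLp.ofLp h) 1
  have h2 := congrFun (congrArg WithLp.ofLp h) 2
  have hpos : ∀ {n : ℕ} (i : Fin n), (0 : ℝ) ≤ i := fun i ↦ Nat.cast_nonneg _
  rcases u with i | ⟨_ | _, _ | _⟩ <;> rcases v with j | ⟨_ | _, _ | _⟩ <;>
    simp only [spinePos, Matrix.cons_val_zero, Matrix.cons_val_one, Matrix.cons_val, cond_true,
      cond_false] at h0 h1 h2
  all_goals first
    | rfl
    | linarith
    | linarith [hpos i]
    | linarith [hpos j]
    | exact congrArg Sum.inl (Fin.ext (by exact_mod_cast add_right_cancel h0))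

/-- The drawing of the spine graph in the planes `z = 0` and `y = 0`. -/
noncomputable def spineDrawing (m : ℕ) : StraightLineDrawing (spineGraph (m + 1)) 3 where
  pos := spinePos (m + 1)
  pos_injective := spinePos_injective _
  vertex_notMem_edge u v w huv hw := by
    obtain ⟨e, he⟩ := exists_spineEdge_eq huv
    exact spinePos_notMem (spineEdgePoint_of_mem he hw) w rfl
  edges_disjoint u v x y huv hxy hne := by
    obtain ⟨e, he⟩ := exists_spineEdge_eq huv
    obtain ⟨f, hf⟩ := exists_spineEdge_eq hxy
    refine Set.disjoint_left.2 fun q hq hq' ↦ hne ?_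
    rw [← he, ← hf, spineEdgePoint_unique (spineEdgePoint_of_mem he hq)
      (spineEdgePoint_of_mem hf hq')]

/-- The coordinate plane on which the `i`-th coordinate vanishes. -/
noncomputable def coordPlane (i : Fin 3) : AffineSubspace ℝ (EuclideanSpace ℝ (Fin 3)) :=
  (LinearMap.ker (EuclideanSpace.proj i : EuclideanSpace ℝ (Fin 3) →L[ℝ] ℝ).toLinearMap).toAffineSubspace

theorem mem_coordPlane {i : Fin 3} {q : EuclideanSpace ℝ (Fin 3)} :
    q ∈ coordPlane i ↔ q i = 0 := by
  simp [coordPlane]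

theorem isFlat_ker {d l : ℕ} {F : Type*} [AddCommGroup F] [Module ℝ F] [Module.Finite ℝ F]
    (L : EuclideanSpace ℝ (Fin d) →ₗ[ℝ] F) (hL : Function.Surjective L)
    (hl : Module.finrank ℝ F + l = d) : IsFlat l (LinearMap.ker L).toAffineSubspace := by
  refine ⟨⟨0, by simp⟩, ?_⟩
  have := LinearMap.finrank_range_add_finrank_ker L
  rw [LinearMap.range_eq_top.2 hL, finrank_top, finrank_euclideanSpace_fin] at this
  rw [Submodule.toAffineSubspace_direction]
  omega

theorem isFlat_coordPlane (i : Fin 3) : IsFlat 2 (coordPlane i) :=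
  isFlat_ker _ (fun r ↦ ⟨EuclideanSpace.single i r, by simp⟩) (by simp)

theorem isFlat_inf_coordPlane {i j : Fin 3} (hij : i ≠ j) :
    IsFlat 1 (coordPlane i ⊓ coordPlane j) := by
  have : coordPlane i ⊓ coordPlane j = (LinearMap.ker
      ((EuclideanSpace.proj i : EuclideanSpace ℝ (Fin 3) →L[ℝ] ℝ).toLinearMap.prod
      (EuclideanSpace.proj j : EuclideanSpace ℝ (Fin 3) →L[ℝ] ℝ).toLinearMap)).toAffineSubspace := by
    ext q
    simp [AffineSubspace.mem_inf_iff, mem_coordPlane]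
  rw [this]
  refine isFlat_ker _ (fun r ↦ ⟨EuclideanSpace.single i r.1 + EuclideanSpace.single j r.2, ?_⟩)
    (by simp)
  ext <;> simp [hij, hij.symm]

theorem spineDrawing_carrier_subset (m : ℕ) :
    (spineDrawing m).carrier ⊆ (coordPlane 2 : Set (EuclideanSpace ℝ (Fin 3))) ∪ coordPlane 1 := by
  have hpos : ∀ w, spinePos (m + 1) w ∈
      (coordPlane 2 : Set (EuclideanSpace ℝ (Fin 3))) ∪ coordPlane 1 := by
    rintro (i | ⟨_ | _, h⟩) <;> simp [mem_coordPlane, spinePos]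
  rintro q (⟨w, rfl⟩ | ⟨u, v, huv, hq⟩)
  · exact hpos w
  rw [← insert_endpoints_openSegment] at hq
  rcases hq with rfl | rfl | hq
  · exact hpos u
  · exact hpos v
  obtain ⟨e, he⟩ := exists_spineEdge_eq huv
  have := spineEdgePoint_of_mem he hq
  simp only [Set.mem_union, SetLike.mem_coe, mem_coordPlane]
  rcases e with i | ⟨i, ⟨_ | _, h⟩⟩ | _ | _ <;> simp only [SpineEdgePoint] at this <;> tauto

theorem spineDrawing_sOppSide (m : ℕ) (c : Bool) :
    (coordPlane 2 ⊓ coordPlane 1).SOppSide ((spineDrawing m).pos (.inr (c, false)))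
      ((spineDrawing m).pos (.inr (c, true))) := by
  refine ⟨(wbtw_midpoint ℝ _ _).wOppSide₁₃ ?_, ?_, ?_⟩ <;>
    cases c <;>
    simp [AffineSubspace.mem_inf_iff, mem_coordPlane, spineDrawing, spinePos, midpoint_eq_smul_add]

theorem strongPlaneCoverNumber_spineGraph {m : ℕ} (hm : 2 ≤ m) :
    strongPlaneCoverNumber (spineGraph (m + 1)) = 2 := by
  have hcard : Fintype.card (Fin (m + 1) ⊕ (Bool × Bool)) = m + 5 := by simp
  refine strongPlaneCoverNumber_eq_two ?_ ?_ (isFlat_coordPlane 2) (isFlat_coordPlane 1)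
    (spineDrawing m) (spineDrawing_carrier_subset m)
  · omega
  · rw [ncard_edgeSet_spineGraph]
    omega

end SpineGraph

theorem mainTheorem3 :
    (∀ (V : Type*) [Fintype V] (G : SimpleGraph V),
      7 ≤ Fintype.card V → strongPlaneCoverNumber G = 2 →
        (∃ A B : AffineSubspace ℝ (EuclideanSpace ℝ (Fin 3)), IsFlat 2 A ∧ IsFlat 2 B ∧ A ≠ B ∧
          ∃ D : StraightLineDrawing G 3,
            D.carrier ⊆ (A : Set (EuclideanSpace ℝ (Fin 3))) ∪ B) ∧
        (G.edgeSet.ncard : ℤ) ≤ 5 * (Fintype.card V : ℤ) - 19) ∧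
    (∀ n : ℕ, 7 ≤ n →
      Fintype.card (Fin (n - 4) ⊕ (Bool × Bool)) = n ∧
      strongPlaneCoverNumber (spineGraph (n - 4)) = 2 ∧
      ((spineGraph (n - 4)).edgeSet.ncard : ℤ) = 5 * (n : ℤ) - 19 ∧
      ∃ A B : AffineSubspace ℝ (EuclideanSpace ℝ (Fin 3)),
        IsFlat 2 A ∧ IsFlat 2 B ∧ IsFlat 1 (A ⊓ B) ∧
        ∃ D : StraightLineDrawing (spineGraph (n - 4)) 3,
          D.carrier ⊆ (A : Set (EuclideanSpace ℝ (Fin 3))) ∪ B ∧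
          (∀ i, D.pos (Sum.inl i) ∈ A ⊓ B) ∧
          (∀ h, D.pos (Sum.inr (false, h)) ∈ A) ∧
          (∀ h, D.pos (Sum.inr (true, h)) ∈ B) ∧
          (∀ c, (A ⊓ B).SOppSide (D.pos (Sum.inr (c, false))) (D.pos (Sum.inr (c, true))))) := by
  refine ⟨fun V _ G hn hG ↦ ?_, fun n hn ↦ ?_⟩
  · obtain ⟨A, B, hA, hB, hAB, D, hD⟩ := exists_two_planes_of_strongPlaneCoverNumber_eq hG
    refine ⟨⟨A, B, hA, hB, hAB, D, hD⟩, ?_⟩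
    have := D.ncard_edgeSet_le_of_two_planes hA hB hAB hD hn
    omega
  · obtain ⟨m, rfl⟩ : ∃ m, n = m + 5 := ⟨n - 5, by omega⟩
    rw [show m + 5 - 4 = m + 1 by omega]
    refine ⟨by simp, strongPlaneCoverNumber_spineGraph (by omega), ?_, coordPlane 2, coordPlane 1,
      isFlat_coordPlane 2, isFlat_coordPlane 1, isFlat_inf_coordPlane (by decide),
      spineDrawing m, spineDrawing_carrier_subset m, ?_, ?_, ?_, spineDrawing_sOppSide m⟩
    · rw [ncard_edgeSet_spineGraph]
      push_cast
      ring
    · intro i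
      simp [AffineSubspace.mem_inf_iff, mem_coordPlane, spineDrawing, spinePos]
    · intro h
      simp [mem_coordPlane, spineDrawing, spinePos]
    · intro h
      simp [mem_coordPlane, spineDrawing, spinePos]
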